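/- **Setting.** Let $d\ge 2$, $\mathcal A=\{1,\dots,d\}$, and let $\boldsymbol\sigma=(\sigma_n)_{n\in\mathbb Z}$ be a sequence of unimodular substitutions over $\mathcal A$, i.e. nonerasing endomorphisms of the free monoid $\mathcal A^*$ whose incidence matrices $M_{\sigma_n}=(|\sigma_n(b)|_a)_{a,b\in\mathcal A}$ satisfy $|\det M_{\sigma_n}|=1$. For $m\le n$ put $\sigma_{[m,n)}=\sigma_m\cdots\sigma_{n-1}$ and $M_{[m,n)}=M_{\sigma_m}\cdots M_{\sigma_{n-1}}$. The sequence is *primitive (in the future)* if for each $m$ there is $n>m$ with $M_{[m,n)}$ positive, *primitive in the past* if for each $n$ there is $m<n$ with $M_{[m,n)}$ positive, and *two-sided primitive* if both hold. A *generalized right* (resp. *left*) *eigenvector* is a vector $\mathbf u$ (resp. $\mathbf v$) in $\mathbb R_{\ge0}^d\setminus\{\mathbf 0\}$ with $\bigcap_{k\in\mathbb N} M_{[0,k)}\mathbb R^d_{\ge0}=\mathbb R_{\ge0}\mathbf u$ (resp. $\bigcap_{k\in\mathbb N} {}^tM_{[-k,0)}\mathbb R^d_{\ge0}=\mathbb R_{\ge0}\mathbf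 v$). Put $\mathbf u_n=M_{[0,n)}^{-1}\mathbf u$, $\mathbf v_n={}^tM_{[0,n)}\mathbf v$ for $n\ge0$ and $\mathbf u_n=M_{[n,0)}\mathbf u$, $\mathbf v_n={}^tM_{[n,0)}^{-1}\mathbf v$ for $n<0$; let $\pi_n$ be the projection along $\mathbb R\mathbf u_n$ onto $\mathbf v_n^\perp$ and $\tilde\pi_n=\mathrm{id}-\pi_n$. Let $\boldsymbol\ell(w)=(|w|_1,\dots,|w|_d)$, let $\preceq$ be the prefix relation and let $\llbracket\mathbf e_a\rrbracket$ be the segment from $\mathbf 0$ to the basis vector $\mathbf e_a$. For $n\in\mathbb Z$, $w\in\mathcal A^*$, $a\in\mathcal A$ define $$\mathcal R_n(w)=\overline{\{\pi_n\boldsymbol\ell(p): pw\preceq\sigma_{[n,m)}(b)\text{ for infinitely many } m\ge n,\ b\in\mathcal A\}},\qquad \mathcal R_n=\mathcal R_n(\text{empty word}),\qquad \hat{\mathcal R}_n(a)=\tilde\pi_n\llbracket\mathbf e_a\rrbracket-\mathcal R_n(a),$$ and, with $E_n=\{(a,p,b)\in\mathcal A\times\mathcal A^*\times\mathcal A: pa\preceq\sigma_n(b)\}$,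 for $(a,p,b)\in E_n$, $$\mathcal R_n(a,p,b)=\pi_n\boldsymbol\ell(p)+M_{\sigma_n}\mathcal R_{n+1}(b),\qquad \hat{\mathcal R}_n(a,p,b)=\tilde\pi_n\llbracket\mathbf e_a\rrbracket-\mathcal R_n(a,p,b).$$ The *tiling condition* says: $\boldsymbol\sigma$ is primitive, has generalized right and left eigenvectors $\mathbf u,\mathbf v$, and for every $n\in\mathbb Z$ the tiles $\mathbf x+\hat{\mathcal R}_n(a)$, $(\mathbf x,a)\in\mathbb Z^d\times\mathcal A$, are closed, cover $\mathbb R^d$, and intersect in Lebesgue measure $0$ for distinct pairs $(\mathbf x,a)$. The *$\mathcal S$-adic mapping family* $(\mathbb T,f_{\boldsymbol\sigma})$ consists of copies $\mathbb T_n$, $n\in\mathbb Z$, of $\mathbb R^d/\mathbb Z^d$ and the maps $f_n=M_{\sigma_n}^{-1}:\mathbb T_n\to\mathbb T_{n+1}$; $f=f_{\boldsymbol\sigma}$ is the induced bijection of $\mathbb T=\coprod_n\mathbb T_n$. A *topological partition* of a space is a finite family of pairwise disjoint open sets whose closures cover the space. For each $n$ let $\mathcal P_n=\{R_{n,i}: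 i\in I_n\}$ be a topological partition of $\mathbb T_n$. * $(\mathcal P_n)$ is a *nonstationary Markov partition* if for every $(i_n)\in\prod_n I_n$, $n\in\mathbb Z$, $m\ge2$: if $R_{k,i_k}\cap f^{-1}(R_{k+1,i_{k+1}})\ne\emptyset$ for all $n\le k<n+m$, then $\bigcap_{j=0}^m f^{-j}(R_{n+j,i_{n+j}})\ne\emptyset$. * It is *generating* if for every $(i_n)\in\prod_n I_n$ the set $\bigcap_{n\in\mathbb N}\overline{\bigcap_{|k|<n}f^{-k}(R_{k,i_k})}$ has at most one point. * It has *Property M*, with horizontal atoms $h_n(p)$ and vertical atoms $v_n(p)$, $p\in R_{n,i}$, if for all $n,i$ the collections $\{h_n(p):p\in R_{n,i}\}$ and $\{v_n(p):p\in R_{n,i}\}$ are partitions of $R_{n,i}$ with $p\in h_n(p)\cap v_n(p)$, are transverse, i.e. $h_n(p)\cap v_n(q)\neq\emptyset$ for all $p,q\in R_{n,i}$, and if $h_{n+1}(p)\subset f_n(h_n(f_n^{-1}p))$ and $f_n(v_n(f_n^{-1}p))\subset v_{n+1}(p)$ for all $p\in f_n(R_{n,i})\cap R_{n+1,j}$,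 for all $n,i,j$. **Theorem.** Let $d\ge2$ and let $\boldsymbol\sigma$ be a sequence of unimodular substitutions over $\{1,\dots,d\}$ that satisfies the tiling condition and all of whose Rauzy fractals $\mathcal R_n$, $n\in\mathbb Z$, are compact. Then the families $$\mathcal P_n^{\mathrm{gen}}=\{\operatorname{int}(\hat{\mathcal R}_n(a,p,b))\bmod\mathbb Z^d:(a,p,b)\in E_n\}\qquad(n\in\mathbb Z)$$ are topological partitions which have Property M for $(\mathbb T,f_{\boldsymbol\sigma})$, with the atoms, for $\mathbf x\in\operatorname{int}(\hat{\mathcal R}_n(a,p,b))$, $$h_n(\mathbf x\bmod\mathbb Z^d)=\tilde\pi_n\mathbf x-\operatorname{int}(\mathcal R_n(a,p,b))\bmod\mathbb Z^d,\qquad v_n(\mathbf x\bmod\mathbb Z^d)=\pi_n\mathbf x+\operatorname{int}(\tilde\pi_n\llbracket\mathbf e_a\rrbracket)\bmod\mathbb Z^d$$ (interiors taken in $\mathbf v_n^\perp$ and in $\mathbb R\mathbf u_n$, respectively), and they form a nonstationary Markov partition for $(\mathbb T,f_{\boldsymbol\sigma})$. If moreover $\boldsymbol\sigma$ is two-sided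 primitive, then this nonstationary Markov partition is generating. -/

import Mathlib

open scoped Pointwise Matrix

noncomputable section

namespace SAdic

/-! ### Mapping families, nonstationary Markov partitions, Property M -/

section MappingFamilies

variable {X : ℤ → Type*} [∀ n, TopologicalSpace (X n)] {ι : ℤ → Type*}

/-- The self-map `f` of the disjoint union `∐ X n` induced by a family of invertible maps
`f n : X n → X (n + 1)`.  It is a bijection, so that all its integer powers are available. -/
def totalMap (f : ∀ n, X n ≃ₜ X (n + 1)) : Equiv.Perm (Σ n, X n) :=
  Equiv.sigmaCongr (Equiv.addRight (1 : ℤ)) (fun n => (f n).toEquiv)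

/-- The atom `R n i ⊆ X n`, seen as a subset of the disjoint union. -/
def atom (R : ∀ n, ι n → Set (X n)) (n : ℤ) (i : ι n) : Set (Σ n, X n) :=
  Sigma.mk n '' R n i

/-- Topological partition: a finite family of pairwise disjoint open sets whose closures cover. -/
structure IsTopologicalPartition {Y : Type*} [TopologicalSpace Y] {κ : Type*}
    (R : κ → Set Y) : Prop where
  finite : Finite κ
  isOpen : ∀ i, IsOpen (R i)
  disjoint : ∀ i j, i ≠ j → Disjoint (R i) (R j)
  cover : ⋃ i, closure (R i) = Set.univ

/-- Nonstationary Markov partition of the mapping family `f`. -/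
structure IsMarkovPartition (f : ∀ n, X n ≃ₜ X (n + 1)) (R : ∀ n, ι n → Set (X n)) : Prop where
  partition : ∀ n, IsTopologicalPartition (R n)
  markov : ∀ (i : ∀ n, ι n) (n : ℤ) (m : ℕ), 2 ≤ m →
    (∀ k : ℤ, n ≤ k → k < n + m →
      (atom R k (i k) ∩ totalMap f ⁻¹' atom R (k + 1) (i (k + 1))).Nonempty) →
    (⋂ j ∈ Finset.range (m + 1),
      ⇑(totalMap f ^ j) ⁻¹' atom R (n + j) (i (n + j))).Nonempty

/-- The generating property of a sequence of partitions for the mapping family `f`. -/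
def IsGenerating (f : ∀ n, X n ≃ₜ X (n + 1)) (R : ∀ n, ι n → Set (X n)) : Prop :=
  ∀ i : ∀ n, ι n,
    (⋂ n : ℕ, closure (⋂ k ∈ {k : ℤ | |k| < n},
      ⇑(totalMap f ^ k) ⁻¹' atom R k (i k))).Subsingleton

/-- `{h p : p ∈ R}` and `{v p : p ∈ R}` are transverse partitions of `R`
(the values of `h` and `v` outside `R` are irrelevant). -/
structure IsTransverse {Y : Type*} (R : Set Y) (h v : Y → Set Y) : Prop where
  h_subset : ∀ p ∈ R, h p ⊆ R
  v_subset : ∀ p ∈ R, v p ⊆ R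
  mem_h : ∀ p ∈ R, p ∈ h p
  mem_v : ∀ p ∈ R, p ∈ v p
  h_partition : ∀ p ∈ R, ∀ q ∈ R, h p = h q ∨ Disjoint (h p) (h q)
  v_partition : ∀ p ∈ R, ∀ q ∈ R, v p = v q ∨ Disjoint (v p) (v q)
  transverse : ∀ p ∈ R, ∀ q ∈ R, (h p ∩ v q).Nonempty

/-- Nonstationary Property M of the sequence of partitions `R` for the mapping family `f`,
realized by the horizontal atoms `h n i p` and the vertical atoms `v n i p`, `p ∈ R n i`. -/
structure PropertyM (f : ∀ n, X n ≃ₜ X (n + 1)) (R : ∀ n, ι n → Set (X n))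
    (h v : ∀ n, ι n → X n → Set (X n)) : Prop where
  partition : ∀ n, IsTopologicalPartition (R n)
  transverse : ∀ n i, IsTransverse (R n i) (h n i) (v n i)
  horizontal : ∀ n i j, ∀ p ∈ f n '' R n i ∩ R (n + 1) j,
    h (n + 1) j p ⊆ f n '' h n i ((f n).symm p)
  vertical : ∀ n i j, ∀ p ∈ f n '' R n i ∩ R (n + 1) j,
    f n '' v n i ((f n).symm p) ⊆ v (n + 1) j p

end MappingFamilies

/-! ### Sequences of matrices -/

section Matrices

variable {d : ℕ}

/-- `M_{[n, n+k)} = M_n M_{n+1} ⋯ M_{n+k-1}`. -/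
def matProd {S : Type*} [Semiring S] (M : ℤ → Matrix (Fin d) (Fin d) S) (n : ℤ) :
    ℕ → Matrix (Fin d) (Fin d) S
  | 0 => 1
  | k + 1 => matProd M n k * M (n + k)

/-- Primitivity in the future. -/
def IsPrimitive (M : ℤ → Matrix (Fin d) (Fin d) ℝ) : Prop :=
  ∀ n : ℤ, ∃ k : ℕ, 0 < k ∧ ∀ a b, 0 < matProd M n k a b

/-- Primitivity in the past. -/
def IsPrimitivePast (M : ℤ → Matrix (Fin d) (Fin d) ℝ) : Prop :=
  ∀ n : ℤ, ∃ k : ℕ, 0 < k ∧ ∀ a b, 0 < matProd M (n - k) k a b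

/-- Generalized right eigenvector: `⋂ M_{[0,k)} ℝ_{≥0}^d = ℝ_{≥0} u`, `u ∈ ℝ_{≥0}^d \ {0}`. -/
def IsGenRightEigenvector (M : ℤ → Matrix (Fin d) (Fin d) ℝ) (u : Fin d → ℝ) : Prop :=
  0 ≤ u ∧ u ≠ 0 ∧
    ⋂ k : ℕ, (fun x => matProd M 0 k *ᵥ x) '' {x | 0 ≤ x} = {x | ∃ t : ℝ, 0 ≤ t ∧ x = t • u}

/-- Generalized left eigenvector: `⋂ (M_{[-k,0)})ᵀ ℝ_{≥0}^d = ℝ_{≥0} v`, `v ∈ ℝ_{≥0}^d \ {0}`. -/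
def IsGenLeftEigenvector (M : ℤ → Matrix (Fin d) (Fin d) ℝ) (v : Fin d → ℝ) : Prop :=
  0 ≤ v ∧ v ≠ 0 ∧
    ⋂ k : ℕ, (fun x => (matProd M (-k) k)ᵀ *ᵥ x) '' {x | 0 ≤ x} =
      {x | ∃ t : ℝ, 0 ≤ t ∧ x = t • v}

/-- The right eigenvector `u_n` of the shifted sequence: `M_{[0,n)}⁻¹ u` for `n ≥ 0` and
`M_{[n,0)} u` for `n < 0`. -/
def uVec (M : ℤ → Matrix (Fin d) (Fin d) ℝ) (u : Fin d → ℝ) (n : ℤ) : Fin d → ℝ :=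
  if 0 ≤ n then (matProd M 0 n.toNat)⁻¹ *ᵥ u else matProd M n (-n).toNat *ᵥ u

/-- The left eigenvector `v_n` of the shifted sequence: `(M_{[0,n)})ᵀ v` for `n ≥ 0` and
`((M_{[n,0)})ᵀ)⁻¹ v` for `n < 0`. -/
def vVec (M : ℤ → Matrix (Fin d) (Fin d) ℝ) (v : Fin d → ℝ) (n : ℤ) : Fin d → ℝ :=
  if 0 ≤ n then (matProd M 0 n.toNat)ᵀ *ᵥ v else ((matProd M n (-n).toNat)ᵀ)⁻¹ *ᵥ v

/-- The projection `π_{u,v}` along `ℝ u` to `v^⊥`. -/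
def projHyp (u v x : Fin d → ℝ) : Fin d → ℝ := x - ((x ⬝ᵥ v) / (u ⬝ᵥ v)) • u

/-- The projection along `v^⊥` to `ℝ u`. -/
def projLine (u v x : Fin d → ℝ) : Fin d → ℝ := ((x ⬝ᵥ v) / (u ⬝ᵥ v)) • u

/-- The interior of `s` relative to the subspace `H`. -/
def relInterior (H s : Set (Fin d → ℝ)) : Set (Fin d → ℝ) :=
  Subtype.val '' interior (Subtype.val ⁻¹' s : Set H)

/-- An indexed tiling of `ℝ^d`: closed sets covering `ℝ^d`, any two tiles with distinct indices
having an intersection of Lebesgue measure zero. -/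
structure IsTiling {κ : Type*} (T : κ → Set (Fin d → ℝ)) : Prop where
  isClosed : ∀ i, IsClosed (T i)
  cover : ⋃ i, T i = Set.univ
  disjoint : ∀ i j, i ≠ j → MeasureTheory.volume (T i ∩ T j) = 0

end Matrices

/-! ### The torus `ℝ^d / ℤ^d` and its automorphisms -/

section Torus

variable {d : ℕ}

/-- Reduction modulo `ℤ^d`. -/
def torusMk (x : Fin d → ℝ) : UnitAddTorus (Fin d) := fun i => (x i : UnitAddCircle)

/-- The endomorphism of the torus given by left multiplication by an integer matrix. -/
def torusEnd (A : Matrix (Fin d) (Fin d) ℤ) (x : UnitAddTorus (Fin d)) : UnitAddTorus (Fin d) :=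
  fun i => ∑ j, A i j • x j

theorem torusEnd_torusMk (A : Matrix (Fin d) (Fin d) ℤ) (x : Fin d → ℝ) :
    torusEnd A (torusMk x) = torusMk (A.map (Int.cast : ℤ → ℝ) *ᵥ x) := by
  funext i
  simp only [torusEnd, torusMk, Matrix.mulVec, dotProduct, Matrix.map_apply]
  have h : ∀ j, A i j • ((x j : ℝ) : UnitAddCircle) = (((A i j : ℝ) * x j : ℝ) : UnitAddCircle) := by
    intro j
    rw [← AddCircle.coe_zsmul, zsmul_eq_mul]
  simp only [h]
  exact (map_sum (QuotientAddGroup.mk' (AddSubgroup.zmultiples (1 : ℝ)))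
    (fun j => (A i j : ℝ) * x j) Finset.univ).symm

theorem torusEnd_one (x : UnitAddTorus (Fin d)) : torusEnd 1 x = x := by
  funext i
  simp [torusEnd, Matrix.one_apply, ite_smul]

theorem torusEnd_mul (A B : Matrix (Fin d) (Fin d) ℤ) (x : UnitAddTorus (Fin d)) :
    torusEnd (A * B) x = torusEnd A (torusEnd B x) := by
  funext i
  simp only [torusEnd, Matrix.mul_apply, Finset.sum_smul, Finset.smul_sum, mul_smul]
  exact Finset.sum_comm

theorem continuous_torusEnd (A : Matrix (Fin d) (Fin d) ℤ) : Continuous (torusEnd A) := by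
  unfold torusEnd
  fun_prop

/-- The automorphism `x ↦ A⁻¹ x` of the torus, for an integer matrix `A` with `|det A| = 1`. -/
def torusInvHomeo (A : Matrix (Fin d) (Fin d) ℤ) (hA : |A.det| = 1) :
    UnitAddTorus (Fin d) ≃ₜ UnitAddTorus (Fin d) where
  toFun := torusEnd A⁻¹
  invFun := torusEnd A
  left_inv x := by
    rw [← torusEnd_mul, Matrix.mul_nonsing_inv A (Int.isUnit_iff_abs_eq.mpr hA), torusEnd_one]
  right_inv x := by
    rw [← torusEnd_mul, Matrix.nonsing_inv_mul A (Int.isUnit_iff_abs_eq.mpr hA), torusEnd_one]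
  continuous_toFun := continuous_torusEnd _
  continuous_invFun := continuous_torusEnd _

end Torus

/-! ### Substitutions -/

/-- A substitution over the alphabet `Fin d`: a nonerasing endomorphism of the free monoid. -/
structure Substitution (d : ℕ) where
  toEnd : Monoid.End (FreeMonoid (Fin d))
  nonerasing : ∀ a, toEnd (FreeMonoid.of a) ≠ 1

section Substitutions

variable {d : ℕ}

/-- `p ⪯ w`: the word `p` is a prefix of the word `w`. -/
def PrefixOf (p w : FreeMonoid (Fin d)) : Prop := ∃ s, p * s = w

/-- The number `|w|_a` of occurrences of the letter `a` in the word `w`. -/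
def occ (w : FreeMonoid (Fin d)) (a : Fin d) : ℕ := (FreeMonoid.toList w).count a

/-- The abelianization `ℓ(w)`, as a vector of `ℝ^d`. -/
def abel (w : FreeMonoid (Fin d)) : Fin d → ℝ := fun a => (occ w a : ℝ)

/-- The incidence matrix `(|σ(b)|_a)_{a,b}`. -/
def Substitution.incidence (σ : Substitution d) : Matrix (Fin d) (Fin d) ℤ :=
  Matrix.of fun a b => (occ (σ.toEnd (FreeMonoid.of b)) a : ℤ)

/-- Unimodularity: `|det M_σ| = 1`. -/
def Substitution.IsUnimodular (σ : Substitution d) : Prop := |σ.incidence.det| = 1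

/-- The composition `σ_{[n, n+k)} = σ_n ∘ σ_{n+1} ∘ ⋯ ∘ σ_{n+k-1}`. -/
def substComp (σ : ℤ → Substitution d) (n : ℤ) : ℕ → Monoid.End (FreeMonoid (Fin d))
  | 0 => 1
  | k + 1 => substComp σ n k * (σ (n + k)).toEnd

/-- The sequence of incidence matrices, with real entries. -/
def incSeq (σ : ℤ → Substitution d) (n : ℤ) : Matrix (Fin d) (Fin d) ℝ :=
  (σ n).incidence.map (Int.cast : ℤ → ℝ)

/-- The `S`-adic mapping family: copies of the torus and the automorphisms
`M_{σ_n}⁻¹ : 𝕋_n → 𝕋_{n+1}`. -/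
def mappingFamily (σ : ℤ → Substitution d) (hσ : ∀ n, (σ n).IsUnimodular) (n : ℤ) :
    (fun _ : ℤ => UnitAddTorus (Fin d)) n ≃ₜ (fun _ : ℤ => UnitAddTorus (Fin d)) (n + 1) :=
  torusInvHomeo (σ n).incidence (hσ n)

end Substitutions

/-! ### Rauzy fractals and Rauzy boxes

Here `u` and `v` are generalized right and left eigenvectors of the sequence of incidence matrices.
They are unique up to positive factors, and no object below changes when `u` or `v` is multiplied by
a positive number. -/

section Rauzy

variable {d : ℕ}

/-- `π_n`, the projection along `ℝ u_n` to `v_n^⊥`. -/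
def piN (σ : ℤ → Substitution d) (u v : Fin d → ℝ) (n : ℤ) : (Fin d → ℝ) → (Fin d → ℝ) :=
  projHyp (uVec (incSeq σ) u n) (vVec (incSeq σ) v n)

/-- The complementary projection, along `v_n^⊥` to `ℝ u_n`. -/
def piTildeN (σ : ℤ → Substitution d) (u v : Fin d → ℝ) (n : ℤ) : (Fin d → ℝ) → (Fin d → ℝ) :=
  projLine (uVec (incSeq σ) u n) (vVec (incSeq σ) v n)

/-- The hyperplane `v_n^⊥`. -/
def hyperplane (σ : ℤ → Substitution d) (v : Fin d → ℝ) (n : ℤ) : Set (Fin d → ℝ) :=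
  {x | x ⬝ᵥ vVec (incSeq σ) v n = 0}

/-- The line `ℝ u_n`. -/
def line (σ : ℤ → Substitution d) (u : Fin d → ℝ) (n : ℤ) : Set (Fin d → ℝ) :=
  {x | ∃ t : ℝ, x = t • uVec (incSeq σ) u n}

/-- The subtile `R_n(w)`: closure of the set of all `π_n ℓ(p)` such that `p w` is a prefix of
`σ_{[n,n+k)}(b)` for infinitely many pairs `(k, b)`. -/
def rauzySubtile (σ : ℤ → Substitution d) (u v : Fin d → ℝ) (n : ℤ) (w : FreeMonoid (Fin d)) :
    Set (Fin d → ℝ) :=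
  closure {x | ∃ p : FreeMonoid (Fin d),
    {kb : ℕ × Fin d | PrefixOf (p * w) (substComp σ n kb.1 (FreeMonoid.of kb.2))}.Infinite ∧
      x = piN σ u v n (abel p)}

/-- The Rauzy fractal `R_n`. -/
def rauzyFractal (σ : ℤ → Substitution d) (u v : Fin d → ℝ) (n : ℤ) : Set (Fin d → ℝ) :=
  rauzySubtile σ u v n 1

/-- The projection to `ℝ u_n` of the segment from `0` to the basis vector `e_a`. -/
def edge (σ : ℤ → Substitution d) (u v : Fin d → ℝ) (n : ℤ) (a : Fin d) : Set (Fin d → ℝ) :=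
  piTildeN σ u v n '' segment ℝ 0 (Pi.single a 1)

/-- The cylinder of the Rauzy box of level `n` for the letter `a`: the Minkowski difference of the
projected segment and the subtile `R_n(a)`. -/
def rauzyBox (σ : ℤ → Substitution d) (u v : Fin d → ℝ) (n : ℤ) (a : Fin d) : Set (Fin d → ℝ) :=
  edge σ u v n a - rauzySubtile σ u v n (FreeMonoid.of a)

/-- The tiling condition, with `u` and `v` as generalized eigenvectors. -/
structure TilingCondition (σ : ℤ → Substitution d) (u v : Fin d → ℝ) : Prop where
  primitive : IsPrimitive (incSeq σ)
  right : IsGenRightEigenvector (incSeq σ) u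
  left : IsGenLeftEigenvector (incSeq σ) v
  tiling : ∀ n : ℤ, IsTiling (fun xa : (Fin d → ℤ) × Fin d =>
    {fun i => (xa.1 i : ℝ)} + rauzyBox σ u v n xa.2)

/-- The set `E_n` of triples `(a, p, b)` such that `p a` is a prefix of `σ_n(b)`. -/
def Edges (σ : ℤ → Substitution d) (n : ℤ) : Type :=
  {e : Fin d × FreeMonoid (Fin d) × Fin d //
    PrefixOf (e.2.1 * FreeMonoid.of e.1) ((σ n).toEnd (FreeMonoid.of e.2.2))}

/-- `R_n(a,p,b) = π_n ℓ(p) + M_{σ_n} R_{n+1}(b)`. -/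
def fineFractal (σ : ℤ → Substitution d) (u v : Fin d → ℝ) (n : ℤ) (e : Edges σ n) :
    Set (Fin d → ℝ) :=
  {piN σ u v n (abel e.1.2.1)} +
    (fun x => incSeq σ n *ᵥ x) '' rauzySubtile σ u v (n + 1) (FreeMonoid.of e.1.2.2)

/-- The refined Rauzy box of the triple `(a,p,b)`: the projected segment of `e_a` minus
`R_n(a,p,b)`. -/
def fineBox (σ : ℤ → Substitution d) (u v : Fin d → ℝ) (n : ℤ) (e : Edges σ n) :
    Set (Fin d → ℝ) :=
  edge σ u v n e.1.1 - fineFractal σ u v n e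

/-- The atoms of the refined partition: interiors of the refined Rauzy boxes, modulo `ℤ^d`. -/
def finePartition (σ : ℤ → Substitution d) (u v : Fin d → ℝ) (n : ℤ) (e : Edges σ n) :
    Set (UnitAddTorus (Fin d)) :=
  torusMk '' interior (fineBox σ u v n e)

/-- The horizontal atom through the point `y = x mod ℤ^d`, with `x` in the interior of the refined
box: the projection of `x` to `ℝ u_n` minus the interior (in `v_n^⊥`) of `R_n(a,p,b)`,
modulo `ℤ^d`. -/
def fineHorizontal (σ : ℤ → Substitution d) (u v : Fin d → ℝ) (n : ℤ) (e : Edges σ n)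
    (y : UnitAddTorus (Fin d)) : Set (UnitAddTorus (Fin d)) :=
  ⋃ x ∈ {x | x ∈ interior (fineBox σ u v n e) ∧ torusMk x = y},
    torusMk '' ({piTildeN σ u v n x} - relInterior (hyperplane σ v n) (fineFractal σ u v n e))

/-- The vertical atom through the point `y = x mod ℤ^d`, with `x` in the interior of the refined
box: `π_n x` plus the interior (in `ℝ u_n`) of the projected segment of `e_a`, modulo `ℤ^d`. -/
def fineVertical (σ : ℤ → Substitution d) (u v : Fin d → ℝ) (n : ℤ) (e : Edges σ n)
    (y : UnitAddTorus (Fin d)) : Set (UnitAddTorus (Fin d)) :=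
  ⋃ x ∈ {x | x ∈ interior (fineBox σ u v n e) ∧ torusMk x = y},
    torusMk '' ({piN σ u v n x} + relInterior (line σ u n) (edge σ u v n e.1.1))

end Rauzy

end SAdic

end

namespace SAdic

/-! ### Matrix products, the vectors `uVec` and `vVec`, and the two projections. -/

section LinearAlgebra

variable {d : ℕ}

/-! Everything is lifted to `ℝ^d`, where a refined box is a product: the height `⟨x, v_n⟩` fills a
strip of height `v_n(a)`, and `-π_n x` ranges over the base `R_n(a,p,b)`. The affine map `x ↦
M_{σ_n}⁻¹ (x + ℓ(p))`, which induces `f_n` on the torus, sends this box to a slab of the box of the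
letter `b` at level `n + 1`: the slab has the full base `R_{n+1}(b)`, and its heights are those that
the letter `a` after `p` occupies in the broken line of `σ_n(b)`. A refined box inside the box of
`b` has, conversely, full height and a smaller base. Slabs of full width and columns of full height
cross, and this is Property M (`propertyM`). That lifts are unique and that the boxes cover follows
from the tiling at level `n + 1` (`eq_of_mem_interior_fineBox`, `exists_mem_fineBox`). Property M
yields the Markov property by splicing an orbit in front of another along a vertical atom
(`PropertyM.exists_orbit`).

For the generating property, two points with the same itinerary have lifts whose difference `w_k`
satisfies `M_{σ_k} w_{k+1} = w_k`. The height of `w_0` equals that of `w_{-m}`, which is at most the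
largest coordinate of `v_{-m}`; primitivity in the past makes this small (`exists_vVec_neg_lt`). The
part of `w_0` in `v^⊥` is the difference of two points of `-M_{[0,n)} R_n(a)`, so these renormalized
subtiles must have small diameter (`exists_norm_matProd_mulVec_sub_lt`).

This contraction follows from tiling and compactness alone. If it failed, there would be vectors
`z_j` bounded away from `0` and segments in direction `u`, of length tending to infinity, along
which `x` and `x - z_j` lie in a common tile of level `0`. In the limit this holds along a whole
line for some `z ≠ 0`. The tiling forces `u` to be rationally independent
(`intVec_dotProduct_ne_zero`), so the line is dense in the torus (`denseRange_torusFlow`) and the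
property holds for all `x`. For a generic `x`, the points `x, x - z, x - 2z, …` then stay in one
bounded tile, whence `z = 0`. -/

theorem matProd_add {S : Type*} [Semiring S] (M : ℤ → Matrix (Fin d) (Fin d) S) (n : ℤ)
    (k l : ℕ) : matProd M n (k + l) = matProd M n k * matProd M (n + k) l := by
  induction l with
  | zero => simp [matProd]
  | succ l ih =>
    rw [← add_assoc, matProd, ih, matProd, Matrix.mul_assoc]
    push_cast
    rw [add_assoc n]

theorem matProd_one {S : Type*} [Semiring S] (M : ℤ → Matrix (Fin d) (Fin d) S) (n : ℤ) :
    matProd M n 1 = M n := by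
  simp [matProd]

theorem matProd_succ_left {S : Type*} [Semiring S] (M : ℤ → Matrix (Fin d) (Fin d) S) (n : ℤ)
    (k : ℕ) : matProd M n (k + 1) = M n * matProd M (n + 1) k := by
  rw [add_comm, matProd_add, matProd_one]
  norm_num

theorem matProd_nonneg {M : ℤ → Matrix (Fin d) (Fin d) ℝ} (hM : ∀ n a b, 0 ≤ M n a b) (n : ℤ)
    (k : ℕ) (a b : Fin d) : 0 ≤ matProd M n k a b := by
  induction k generalizing b with
  | zero =>
    rw [matProd, Matrix.one_apply]
    split_ifs <;> norm_num
  | succ k ih =>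
    rw [matProd, Matrix.mul_apply]
    exact Finset.sum_nonneg fun c _ => mul_nonneg (ih c) (hM _ _ _)

theorem isUnit_det_matProd {M : ℤ → Matrix (Fin d) (Fin d) ℝ} (hM : ∀ n, IsUnit (M n).det) (n : ℤ)
    (k : ℕ) : IsUnit (matProd M n k).det := by
  induction k with
  | zero => simp [matProd]
  | succ k ih =>
    rw [matProd, Matrix.det_mul]
    exact ih.mul (hM _)

theorem uVec_zero (M : ℤ → Matrix (Fin d) (Fin d) ℝ) (u : Fin d → ℝ) : uVec M u 0 = u := by
  simp [uVec, matProd]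

theorem vVec_zero (M : ℤ → Matrix (Fin d) (Fin d) ℝ) (v : Fin d → ℝ) : vVec M v 0 = v := by
  simp [vVec, matProd]

/-- A recursion valid on all of `ℤ`, so that the definition by the sign of `n` is not needed again.
-/
theorem uVec_eq_mulVec_succ {M : ℤ → Matrix (Fin d) (Fin d) ℝ} (hM : ∀ n, IsUnit (M n).det)
    (u : Fin d → ℝ) (n : ℤ) : uVec M u n = M n *ᵥ uVec M u (n + 1) := by
  obtain ⟨k, rfl | rfl⟩ := Int.eq_nat_or_neg n
  · have h1 : ((k : ℤ) + 1).toNat = k + 1 := by omega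
    rw [uVec, uVec, if_pos (by omega), if_pos (by omega), h1, matProd, Matrix.mul_inv_rev,
      Int.toNat_natCast, zero_add, Matrix.mulVec_mulVec, ← Matrix.mul_assoc,
      Matrix.mul_nonsing_inv _ (hM _), Matrix.one_mul]
  · cases k with
    | zero => simp [uVec, matProd, Matrix.mul_nonsing_inv _ (hM _)]
    | succ k =>
      rw [uVec, if_neg (by omega)]
      have h1 : (-(-((k + 1 : ℕ) : ℤ))).toNat = k + 1 := by omega
      rw [h1, matProd_succ_left, ← Matrix.mulVec_mulVec]
      have h2 : -((k + 1 : ℕ) : ℤ) + 1 = -(k : ℤ) := by push_cast; ring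
      rw [h2]
      congr 1
      cases k with
      | zero => simp [uVec, matProd]
      | succ k =>
        rw [uVec, if_neg (by omega)]
        congr 2

theorem vVec_succ {M : ℤ → Matrix (Fin d) (Fin d) ℝ} (hM : ∀ n, IsUnit (M n).det)
    (v : Fin d → ℝ) (n : ℤ) : vVec M v (n + 1) = (M n)ᵀ *ᵥ vVec M v n := by
  have hT : ∀ n, IsUnit (M n)ᵀ.det := fun n => by rw [Matrix.det_transpose]; exact hM n
  obtain ⟨k, rfl | rfl⟩ := Int.eq_nat_or_neg n
  · have h1 : ((k : ℤ) + 1).toNat = k + 1 := by omega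
    rw [vVec, vVec, if_pos (by omega), if_pos (by omega), h1, matProd, Matrix.transpose_mul,
      Int.toNat_natCast, zero_add, Matrix.mulVec_mulVec]
  · cases k with
    | zero => simp [vVec, matProd]
    | succ k =>
      have h1 : (-(-((k + 1 : ℕ) : ℤ))).toNat = k + 1 := by omega
      have h2 : -((k + 1 : ℕ) : ℤ) + 1 = -(k : ℤ) := by push_cast; ring
      rw [h2]
      conv_rhs => rw [vVec, if_neg (by omega), h1, matProd_succ_left, Matrix.transpose_mul,
        Matrix.mul_inv_rev, Matrix.mulVec_mulVec, ← Matrix.mul_assoc,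
        Matrix.mul_nonsing_inv _ (hT _), Matrix.one_mul, h2]
      cases k with
      | zero => simp [vVec, matProd]
      | succ k =>
        rw [vVec, if_neg (by omega)]
        congr 3

theorem uVec_eq_matProd_mulVec {M : ℤ → Matrix (Fin d) (Fin d) ℝ} (hM : ∀ n, IsUnit (M n).det)
    (u : Fin d → ℝ) (n : ℤ) (k : ℕ) : uVec M u n = matProd M n k *ᵥ uVec M u (n + k) := by
  induction k with
  | zero => simp [matProd]
  | succ k ih =>
    rw [ih, uVec_eq_mulVec_succ hM, Matrix.mulVec_mulVec, matProd]
    push_cast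
    rw [add_assoc]

theorem vVec_add {M : ℤ → Matrix (Fin d) (Fin d) ℝ} (hM : ∀ n, IsUnit (M n).det)
    (v : Fin d → ℝ) (n : ℤ) (k : ℕ) : vVec M v (n + k) = (matProd M n k)ᵀ *ᵥ vVec M v n := by
  induction k with
  | zero => simp [matProd]
  | succ k ih =>
    rw [matProd, Matrix.transpose_mul, ← Matrix.mulVec_mulVec, ← ih, ← vVec_succ hM]
    push_cast
    rw [add_assoc]

theorem mulVec_dotProduct_eq (A : Matrix (Fin d) (Fin d) ℝ) (x y : Fin d → ℝ) :
    (A *ᵥ x) ⬝ᵥ y = x ⬝ᵥ (Aᵀ *ᵥ y) := by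
  rw [Matrix.mulVec_transpose, dotProduct_comm, Matrix.dotProduct_mulVec, dotProduct_comm]

theorem matProd_mulVec_dotProduct_vVec {M : ℤ → Matrix (Fin d) (Fin d) ℝ}
    (hM : ∀ n, IsUnit (M n).det) (v : Fin d → ℝ) (n : ℤ) (k : ℕ) (x : Fin d → ℝ) :
    (matProd M n k *ᵥ x) ⬝ᵥ vVec M v n = x ⬝ᵥ vVec M v (n + k) := by
  rw [mulVec_dotProduct_eq, vVec_add hM]

/-- The matrices act on `u_n` and, transposed, on `v_n` in opposite directions, so the pairing is
conserved along the sequence. Its positivity then has to be checked at level `0` only. -/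
theorem uVec_dotProduct_vVec {M : ℤ → Matrix (Fin d) (Fin d) ℝ}
    (hM : ∀ n, IsUnit (M n).det) (u v : Fin d → ℝ) (n : ℤ) :
    uVec M u n ⬝ᵥ vVec M v n = u ⬝ᵥ v := by
  have key : ∀ (n : ℤ) (k : ℕ), uVec M u n ⬝ᵥ vVec M v n =
      uVec M u (n + k) ⬝ᵥ vVec M v (n + k) := fun n k => by
    rw [uVec_eq_matProd_mulVec hM u n k, matProd_mulVec_dotProduct_vVec hM]
  obtain ⟨k, rfl | rfl⟩ := Int.eq_nat_or_neg n
  · have := key 0 k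
    rw [uVec_zero, vVec_zero, zero_add] at this
    exact this.symm
  · have := key (-k) k
    rwa [neg_add_cancel, uVec_zero, vVec_zero] at this

theorem dotProduct_pos_of_pos {x y : Fin d → ℝ} (hx : ∀ a, 0 < x a) (hy : 0 ≤ y) (hy0 : y ≠ 0) :
    0 < x ⬝ᵥ y := by
  obtain ⟨a, ha⟩ := Function.ne_iff.mp hy0
  exact Finset.sum_pos' (fun b _ => mul_nonneg (hx b).le (hy b))
    ⟨a, Finset.mem_univ a, mul_pos (hx a) (lt_of_le_of_ne (hy a) (Ne.symm ha))⟩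

theorem mulVec_pos_of_pos {A : Matrix (Fin d) (Fin d) ℝ} (hA : ∀ a b, 0 < A a b) {x : Fin d → ℝ}
    (hx : 0 ≤ x) (hx0 : x ≠ 0) (a : Fin d) : 0 < (A *ᵥ x) a :=
  dotProduct_pos_of_pos (hA a) hx hx0

/-- The vector `u` lies in the image of the cone under a positive product `M_{[0,k)}`, and such a
product maps nonzero vectors of the cone into its interior. -/
theorem IsGenRightEigenvector.pos {M : ℤ → Matrix (Fin d) (Fin d) ℝ} {u : Fin d → ℝ}
    (hu : IsGenRightEigenvector M u) (hM : IsPrimitive M) (a : Fin d) : 0 < u a := by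
  obtain ⟨k, -, hk⟩ := hM 0
  have h : u ∈ {x : Fin d → ℝ | ∃ t : ℝ, 0 ≤ t ∧ x = t • u} := ⟨1, zero_le_one, (one_smul _ _).symm⟩
  rw [← hu.2.2] at h
  obtain ⟨x, hx, hxu⟩ := Set.mem_iInter.mp h k
  simp only at hxu
  rw [← hxu]
  refine mulVec_pos_of_pos hk hx ?_ a
  rintro rfl
  exact hu.2.1 (by simpa using hxu.symm)

/-- For `n < 0`, `v` lies in the image of the cone under the transpose of `M_{[n,0)}`, which is
injective. Strict positivity is neither available here nor needed: a letter with `v_n(a) = 0` has a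
box with empty interior. -/
theorem IsGenLeftEigenvector.vVec_nonneg {M : ℤ → Matrix (Fin d) (Fin d) ℝ} {v : Fin d → ℝ}
    (hv : IsGenLeftEigenvector M v) (hdet : ∀ n, IsUnit (M n).det) (hM : ∀ n a b, 0 ≤ M n a b)
    (n : ℤ) : 0 ≤ vVec M v n := by
  by_cases hn : 0 ≤ n
  · rw [vVec, if_pos hn]
    exact fun a => dotProduct_nonneg_of_nonneg (fun b => matProd_nonneg hM _ _ _ _) hv.1
  · have h : v ∈ {x : Fin d → ℝ | ∃ t : ℝ, 0 ≤ t ∧ x = t • v} :=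
      ⟨1, zero_le_one, (one_smul _ _).symm⟩
    rw [← hv.2.2] at h
    obtain ⟨x, hx, hxv⟩ := Set.mem_iInter.mp h (-n).toNat
    have h1 : -((-n).toNat : ℤ) = n := by omega
    simp only [h1] at hxv
    rw [vVec, if_neg hn, ← hxv, Matrix.mulVec_mulVec, Matrix.nonsing_inv_mul, Matrix.one_mulVec]
    · exact hx
    · rw [Matrix.det_transpose]
      exact isUnit_det_matProd hdet _ _

theorem projHyp_add_projLine (u v x : Fin d → ℝ) : projHyp u v x + projLine u v x = x := by
  simp [projHyp, projLine]

/-- The change of level: an invertible matrix carries the splitting into line and hyperplane of one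
level to that of the preceding one. -/
theorem projHyp_mulVec (A : Matrix (Fin d) (Fin d) ℝ) (u v x : Fin d → ℝ) :
    projHyp (A *ᵥ u) v (A *ᵥ x) = A *ᵥ projHyp u (Aᵀ *ᵥ v) x := by
  simp only [projHyp, mulVec_dotProduct_eq, Matrix.mulVec_sub, Matrix.mulVec_smul]

theorem projHyp_add (u v x y : Fin d → ℝ) :
    projHyp u v (x + y) = projHyp u v x + projHyp u v y := by
  simp only [projHyp, add_dotProduct, add_div, add_smul]
  abel

theorem projHyp_neg (u v x : Fin d → ℝ) : projHyp u v (-x) = -projHyp u v x := by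
  simp only [projHyp, neg_dotProduct, neg_div, neg_smul]
  abel

theorem projHyp_sub (u v x y : Fin d → ℝ) :
    projHyp u v (x - y) = projHyp u v x - projHyp u v y := by
  rw [sub_eq_add_neg, projHyp_add, projHyp_neg, sub_eq_add_neg]

theorem continuous_projHyp (u v : Fin d → ℝ) : Continuous (projHyp u v) := by
  unfold projHyp dotProduct
  fun_prop

theorem continuous_projLine (u v : Fin d → ℝ) : Continuous (projLine u v) := by
  unfold projLine dotProduct
  fun_prop

theorem projHyp_dotProduct {u v : Fin d → ℝ} (h : u ⬝ᵥ v ≠ 0) (x : Fin d → ℝ) :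
    projHyp u v x ⬝ᵥ v = 0 := by
  simp [projHyp, sub_dotProduct, smul_dotProduct, h]

theorem projHyp_of_dotProduct_eq_zero {u v x : Fin d → ℝ} (h : x ⬝ᵥ v = 0) :
    projHyp u v x = x := by
  simp [projHyp, h]

theorem projHyp_smul_self {u v : Fin d → ℝ} (h : u ⬝ᵥ v ≠ 0) (t : ℝ) :
    projHyp u v (t • u) = 0 := by
  simp [projHyp, smul_dotProduct, h]

theorem projLine_dotProduct {u v : Fin d → ℝ} (h : u ⬝ᵥ v ≠ 0) (x : Fin d → ℝ) :
    projLine u v x ⬝ᵥ v = x ⬝ᵥ v := by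
  simp [projLine, smul_dotProduct, h]

theorem projLine_eq_iff {u v : Fin d → ℝ} (h : u ⬝ᵥ v ≠ 0) {x y : Fin d → ℝ} :
    projLine u v x = projLine u v y ↔ x ⬝ᵥ v = y ⬝ᵥ v :=
  ⟨fun hxy => by rw [← projLine_dotProduct h x, hxy, projLine_dotProduct h],
    fun hxy => by rw [projLine, hxy, projLine]⟩

end LinearAlgebra

/-! ### Words, prefixes and their abelianizations. -/

section Words

variable {d : ℕ}

theorem abel_one : abel (1 : FreeMonoid (Fin d)) = 0 := by
  funext a
  simp [abel, occ]

theorem abel_mul (p q : FreeMonoid (Fin d)) : abel (p * q) = abel p + abel q := by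
  funext a
  simp [abel, occ]

theorem abel_of (a : Fin d) : abel (FreeMonoid.of a) = Pi.single a 1 := by
  funext b
  rcases eq_or_ne b a with rfl | h
  · simp [abel, occ]
  · simp [abel, occ, h, h.symm]

theorem incSeq_mulVec_abel (σ : ℤ → Substitution d) (n : ℤ) (w : FreeMonoid (Fin d)) :
    incSeq σ n *ᵥ abel w = abel ((σ n).toEnd w) := by
  induction w using FreeMonoid.inductionOn' with
  | one => simp [abel_one]
  | of_mul a w ih =>
    rw [abel_mul, Matrix.mulVec_add, ih, map_mul, abel_mul, abel_of, Matrix.mulVec_single_one]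
    congr 1

theorem matProd_mulVec_abel (σ : ℤ → Substitution d) (n : ℤ) (k : ℕ) (w : FreeMonoid (Fin d)) :
    matProd (incSeq σ) n k *ᵥ abel w = abel (substComp σ n k w) := by
  induction k generalizing w with
  | zero => simp [matProd, substComp]
  | succ k ih =>
    rw [matProd, ← Matrix.mulVec_mulVec, incSeq_mulVec_abel, ih]
    rfl

theorem substComp_add (σ : ℤ → Substitution d) (n : ℤ) (k l : ℕ) :
    substComp σ n (k + l) = substComp σ n k * substComp σ (n + k) l := by
  induction l with
  | zero => simp [substComp]
  | succ l ih =>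
    rw [← add_assoc, substComp, ih, substComp, mul_assoc]
    push_cast
    rw [add_assoc n]

theorem substComp_one (σ : ℤ → Substitution d) (n : ℤ) : substComp σ n 1 = (σ n).toEnd := by
  simp [substComp]

theorem incSeq_nonneg (σ : ℤ → Substitution d) (n : ℤ) (a b : Fin d) : 0 ≤ incSeq σ n a b := by
  simp [incSeq, Substitution.incidence]

theorem isUnit_det_incSeq {σ : ℤ → Substitution d} (hσ : ∀ n, (σ n).IsUnimodular) (n : ℤ) :
    IsUnit (incSeq σ n).det := by
  have h : (incSeq σ n).det = (((σ n).incidence.det : ℤ) : ℝ) :=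
    (RingHom.map_det (Int.castRingHom ℝ) (σ n).incidence).symm
  rw [h, isUnit_iff_ne_zero, Int.cast_ne_zero]
  intro h0
  have := hσ n
  rw [Substitution.IsUnimodular, h0] at this
  norm_num at this

theorem PrefixOf.trans {p q w : FreeMonoid (Fin d)} (h : PrefixOf p q) (h' : PrefixOf q w) :
    PrefixOf p w := by
  obtain ⟨s, rfl⟩ := h
  obtain ⟨t, rfl⟩ := h'
  exact ⟨s * t, (mul_assoc _ _ _).symm⟩

theorem PrefixOf.of_mul_right {p q w : FreeMonoid (Fin d)} (h : PrefixOf (p * q) w) :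
    PrefixOf p w :=
  PrefixOf.trans ⟨q, rfl⟩ h

theorem PrefixOf.mul_left {p q : FreeMonoid (Fin d)} (h : PrefixOf p q) (w : FreeMonoid (Fin d)) :
    PrefixOf (w * p) (w * q) := by
  obtain ⟨s, rfl⟩ := h
  exact ⟨s, mul_assoc _ _ _⟩

theorem PrefixOf.map {p q : FreeMonoid (Fin d)} (h : PrefixOf p q)
    (f : Monoid.End (FreeMonoid (Fin d))) : PrefixOf (f p) (f q) := by
  obtain ⟨s, rfl⟩ := h
  exact ⟨f s, (map_mul f _ _).symm⟩

theorem prefixOf_iff_toList {p w : FreeMonoid (Fin d)} : PrefixOf p w ↔ p.toList <+: w.toList := by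
  constructor
  · rintro ⟨s, rfl⟩
    exact ⟨s.toList, rfl⟩
  · rintro ⟨s, hs⟩
    exact ⟨FreeMonoid.ofList s, hs⟩

/-- Two occurrences of letters in one word coincide, or one of them precedes the other. -/
theorem PrefixOf.mul_of_trichotomy {p q w : FreeMonoid (Fin d)} {a b : Fin d}
    (h : PrefixOf (p * FreeMonoid.of a) w) (h' : PrefixOf (q * FreeMonoid.of b) w) :
    (p = q ∧ a = b) ∨ PrefixOf (p * FreeMonoid.of a) q ∨ PrefixOf (q * FreeMonoid.of b) p := by
  simp only [prefixOf_iff_toList, FreeMonoid.toList_mul, FreeMonoid.toList_of] at h h' ⊢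
  have hp := (List.prefix_append _ _).trans h
  have hq := (List.prefix_append _ _).trans h'
  rcases lt_trichotomy p.toList.length q.toList.length with hl | hl | hl
  · exact .inr (.inl (List.prefix_of_prefix_length_le h hq (by simp; omega)))
  · left
    have := List.IsPrefix.eq_of_length (List.prefix_of_prefix_length_le h h' (by simp [hl]))
      (by simp [hl])
    have := List.append_inj this hl
    exact ⟨FreeMonoid.toList.injective this.1, by simpa using this.2⟩
  · exact .inr (.inr (List.prefix_of_prefix_length_le h' hp (by simp; omega)))

instance finite_edges (σ : ℤ → Substitution d) (n : ℤ) : Finite (Edges σ n) := by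
  let f : Edges σ n → Fin d × Σ b : Fin d,
      {l : List (Fin d) // l ∈ ((σ n).toEnd (FreeMonoid.of b)).toList.inits} := fun e =>
    ⟨e.1.1, e.1.2.2, e.1.2.1.toList, by
      rw [List.mem_inits]
      -- For given `b`, the word `p` is one of the finitely many prefixes of `σ_n(b)`.
      exact prefixOf_iff_toList.mp e.2.of_mul_right⟩
  have (b : Fin d) :
      Finite {l : List (Fin d) // l ∈ ((σ n).toEnd (FreeMonoid.of b)).toList.inits} :=
    (List.finite_toSet _).to_subtype
  refine Finite.of_injective f ?_
  rintro ⟨⟨a, p, b⟩, h⟩ ⟨⟨a', p', b'⟩, h'⟩ hf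
  simp only [f, Prod.mk.injEq, Sigma.mk.injEq] at hf
  obtain ⟨rfl, rfl, hp⟩ := hf
  simp only [heq_eq_eq, Subtype.mk.injEq] at hp
  have := FreeMonoid.toList.injective hp
  subst this
  rfl

/-- The letter of a word whose segment, in the broken line of the word measured by a nonnegative
linear form, covers a given height. -/
theorem exists_prefixOf_dotProduct_le (v : Fin d → ℝ) {w : FreeMonoid (Fin d)} (hw : w ≠ 1) {t : ℝ}
    (h0 : 0 ≤ t) (ht : t ≤ abel w ⬝ᵥ v) :
    ∃ p a, PrefixOf (p * FreeMonoid.of a) w ∧ abel p ⬝ᵥ v ≤ t ∧ t ≤ abel p ⬝ᵥ v + v a := by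
  induction w using FreeMonoid.inductionOn' generalizing t with
  | one => exact absurd rfl hw
  | of_mul a w ih =>
    rw [abel_mul, abel_of, add_dotProduct, single_one_dotProduct] at ht
    by_cases hta : t ≤ v a
    · refine ⟨1, a, ?_, ?_, ?_⟩
      · rw [one_mul]; exact ⟨w, rfl⟩
      · simpa [abel_one] using h0
      · simpa [abel_one] using hta
    · have hw' : w ≠ 1 := by
        rintro rfl
        simp [abel_one] at ht
        exact hta ht
      obtain ⟨p, c, hp, h1, h2⟩ := ih hw' (t := t - v a) (by linarith) (by linarith)
      refine ⟨FreeMonoid.of a * p, c, ?_, ?_, ?_⟩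
      · rw [mul_assoc]; exact hp.mul_left _
      · rw [abel_mul, abel_of, add_dotProduct, single_one_dotProduct]; linarith
      · rw [abel_mul, abel_of, add_dotProduct, single_one_dotProduct]; linarith

theorem abel_dotProduct_le_of_prefixOf {v : Fin d → ℝ} (hv : 0 ≤ v) {p q : FreeMonoid (Fin d)}
    (h : PrefixOf p q) : abel p ⬝ᵥ v ≤ abel q ⬝ᵥ v := by
  obtain ⟨s, rfl⟩ := h
  rw [abel_mul, add_dotProduct, le_add_iff_nonneg_right]
  exact dotProduct_nonneg_of_nonneg (fun a => Nat.cast_nonneg _) hv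

theorem substComp_of_ne_one (σ : ℤ → Substitution d) (n : ℤ) (k : ℕ) (a : Fin d) :
    substComp σ n k (FreeMonoid.of a) ≠ 1 := by
  -- The induction has to run over all words, because the image of a letter is a word.
  have key : ∀ w : FreeMonoid (Fin d), substComp σ n k w = 1 → w = 1 := by
    induction k with
    | zero => exact fun w h => h
    | succ k ih =>
      intro w h
      have h1 := ih _ h
      induction w using FreeMonoid.inductionOn' with
      | one => rfl
      | of_mul a w _ =>
        have h2 : (σ (n + k)).toEnd (FreeMonoid.of a) * (σ (n + k)).toEnd w = 1 :=
          (map_mul _ _ _).symm.trans h1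
        exact absurd (mul_eq_one'.mp h2).1 ((σ _).nonerasing a)
  exact fun h => FreeMonoid.of_ne_one a (key _ h)

end Words

/-! ### Subtiles of the Rauzy fractals under change of level. -/

section Subtiles

variable {d : ℕ} {σ : ℤ → Substitution d}

theorem piN_matProd_mulVec (hσ : ∀ n, (σ n).IsUnimodular) (u v : Fin d → ℝ) (n : ℤ) (k : ℕ)
    (x : Fin d → ℝ) :
    piN σ u v n (matProd (incSeq σ) n k *ᵥ x) = matProd (incSeq σ) n k *ᵥ piN σ u v (n + k) x := by
  rw [piN, piN, uVec_eq_matProd_mulVec (isUnit_det_incSeq hσ) u n k, projHyp_mulVec,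
    vVec_add (isUnit_det_incSeq hσ)]

theorem piN_incSeq_mulVec (hσ : ∀ n, (σ n).IsUnimodular) (u v : Fin d → ℝ) (n : ℤ)
    (x : Fin d → ℝ) :
    piN σ u v n (incSeq σ n *ᵥ x) = incSeq σ n *ᵥ piN σ u v (n + 1) x := by
  have := piN_matProd_mulVec hσ u v n 1 x
  rwa [matProd_one] at this

theorem rauzySubtile_subset_rauzyFractal (u v : Fin d → ℝ) (n : ℤ) (w : FreeMonoid (Fin d)) :
    rauzySubtile σ u v n w ⊆ rauzyFractal σ u v n := by
  refine closure_mono ?_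
  rintro x ⟨p, hp, rfl⟩
  refine ⟨p, hp.mono fun kb h => ?_, rfl⟩
  rw [Set.mem_ofPred_eq, mul_one]
  exact PrefixOf.of_mul_right h

theorem isCompact_rauzySubtile {u v : Fin d → ℝ}
    (hc : ∀ n, IsCompact (rauzyFractal σ u v n)) (n : ℤ) (w : FreeMonoid (Fin d)) :
    IsCompact (rauzySubtile σ u v n w) :=
  (hc n).of_isClosed_subset isClosed_closure (rauzySubtile_subset_rauzyFractal u v n w)

/-- One half of the set equation for the subtiles. -/
theorem piN_add_matProd_mulVec_mem_rauzySubtile (hσ : ∀ n, (σ n).IsUnimodular) (u v : Fin d → ℝ)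
    {n : ℤ} {k : ℕ} {p : FreeMonoid (Fin d)} {a b : Fin d}
    (h : PrefixOf (p * FreeMonoid.of a) (substComp σ n k (FreeMonoid.of b))) {x : Fin d → ℝ}
    (hx : x ∈ rauzySubtile σ u v (n + k) (FreeMonoid.of b)) :
    piN σ u v n (abel p) + matProd (incSeq σ) n k *ᵥ x ∈
      rauzySubtile σ u v n (FreeMonoid.of a) := by
  have hcont : Continuous fun x : Fin d → ℝ =>
      piN σ u v n (abel p) + matProd (incSeq σ) n k *ᵥ x := by fun_prop
  refine map_mem_closure (f := fun x : Fin d → ℝ =>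
    piN σ u v n (abel p) + matProd (incSeq σ) n k *ᵥ x) hcont hx ?_
  rintro _ ⟨q, hq, rfl⟩
  -- If `q b` is a prefix of `σ_{[n+k,m)}(c)` and `p a` one of `σ_{[n,n+k)}(b)`, then
  -- `σ_{[n,n+k)}(q) p a` is a prefix of `σ_{[n,m)}(c)`. Shifting the length by `k` is injective, so
  -- infinitely many witnesses remain.
  refine ⟨substComp σ n k q * p, ?_, ?_⟩
  · refine Set.infinite_of_injOn_mapsTo (f := fun kb : ℕ × Fin d => (k + kb.1, kb.2)) ?_ ?_ hq
    · rintro ⟨i, c⟩ - ⟨j, c'⟩ - hij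
      simpa using hij
    · rintro ⟨i, c⟩ hi
      rw [Set.mem_ofPred_eq, substComp_add, mul_assoc]
      refine (h.mul_left _).trans ?_
      rw [← map_mul]
      exact PrefixOf.map hi _
  · beta_reduce
    rw [abel_mul, ← matProd_mulVec_abel, ← piN_matProd_mulVec hσ, piN, projHyp_add, add_comm]

theorem rauzySubtile_dotProduct_vVec {u v : Fin d → ℝ} (hσ : ∀ n, (σ n).IsUnimodular)
    (huv : u ⬝ᵥ v ≠ 0) {n : ℤ} {w : FreeMonoid (Fin d)} {x : Fin d → ℝ}
    (hx : x ∈ rauzySubtile σ u v n w) : x ⬝ᵥ vVec (incSeq σ) v n = 0 := by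
  have hcl : IsClosed {x : Fin d → ℝ | x ⬝ᵥ vVec (incSeq σ) v n = 0} :=
    isClosed_eq (by unfold dotProduct; fun_prop) continuous_const
  refine closure_minimal ?_ hcl hx
  rintro _ ⟨p, -, rfl⟩
  exact projHyp_dotProduct (by rwa [uVec_dotProduct_vVec (isUnit_det_incSeq hσ)]) _

end Subtiles

/-! ### The integer lattice and reduction to the torus. -/

section Lattice

variable {d : ℕ}

/-- An integer vector, as a vector of `ℝ^d`. -/
def intVec (k : Fin d → ℤ) : Fin d → ℝ := fun i => (k i : ℝ)

theorem intVec_add (k l : Fin d → ℤ) : intVec (k + l) = intVec k + intVec l := by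
  funext i
  simp [intVec]

theorem intVec_sub (k l : Fin d → ℤ) : intVec (k - l) = intVec k - intVec l := by
  funext i
  simp [intVec]

theorem intVec_mulVec (A : Matrix (Fin d) (Fin d) ℤ) (k : Fin d → ℤ) :
    intVec (A *ᵥ k) = A.map (Int.cast : ℤ → ℝ) *ᵥ intVec k := by
  funext i
  simp [intVec, Matrix.mulVec, dotProduct]

theorem intVec_occ (w : FreeMonoid (Fin d)) : intVec (fun a => (occ w a : ℤ)) = abel w := by
  funext i
  simp [intVec, abel]

theorem exists_eq_intVec_of_mulVec {A : Matrix (Fin d) (Fin d) ℤ} (hA : |A.det| = 1)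
    {x : Fin d → ℝ} {k : Fin d → ℤ} (h : A.map (Int.cast : ℤ → ℝ) *ᵥ x = intVec k) :
    ∃ l, x = intVec l := by
  refine ⟨A⁻¹ *ᵥ k, ?_⟩
  have h1 : A⁻¹.map (Int.cast : ℤ → ℝ) * A.map (Int.cast : ℤ → ℝ) = 1 := by
    have h2 := congrArg (fun B : Matrix (Fin d) (Fin d) ℤ => B.map (Int.castRingHom ℝ))
      (Matrix.nonsing_inv_mul A (Int.isUnit_iff_abs_eq.mpr hA))
    rw [Matrix.map_mul] at h2
    simpa using h2
  rw [intVec_mulVec, ← h, Matrix.mulVec_mulVec, h1, Matrix.one_mulVec]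

theorem torusMk_eq_iff {x y : Fin d → ℝ} :
    torusMk x = torusMk y ↔ ∃ k : Fin d → ℤ, x = y + intVec k := by
  have h1 : ∀ s t : ℝ, (s : UnitAddCircle) = (t : UnitAddCircle) ↔ ∃ m : ℤ, s = t + m := by
    intro s t
    rw [eq_comm, QuotientAddGroup.eq, AddSubgroup.mem_zmultiples_iff]
    refine exists_congr fun m => ?_
    rw [zsmul_one]
    constructor <;> intro h <;> linarith
  constructor
  · intro h
    choose k hk using fun i => (h1 _ _).mp (congrFun h i)
    exact ⟨k, funext hk⟩
  · rintro ⟨k, rfl⟩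
    funext i
    exact (h1 _ _).mpr ⟨k i, rfl⟩

theorem torusMk_surjective : Function.Surjective (torusMk (d := d)) := by
  intro y
  choose x hx using fun i => QuotientAddGroup.mk_surjective (y i)
  exact ⟨x, funext hx⟩

theorem continuous_torusMk : Continuous (torusMk (d := d)) :=
  continuous_pi fun i => (AddCircle.continuous_mk' (1 : ℝ)).comp (continuous_apply i)

theorem isOpenMap_torusMk : IsOpenMap (torusMk (d := d)) :=
  IsOpenMap.piMap (fun _ => QuotientAddGroup.isOpenMap_coe) (by simp)

end Lattice

/-! ### Rauzy boxes as products of a height interval and a base in the hyperplane. -/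

section Boxes

variable {d : ℕ} {σ : ℤ → Substitution d} {u v : Fin d → ℝ}

theorem piN_add (n : ℤ) (x y : Fin d → ℝ) :
    piN σ u v n (x + y) = piN σ u v n x + piN σ u v n y :=
  projHyp_add _ _ _ _

theorem piN_sub (n : ℤ) (x y : Fin d → ℝ) :
    piN σ u v n (x - y) = piN σ u v n x - piN σ u v n y :=
  projHyp_sub _ _ _ _

theorem piN_neg (n : ℤ) (x : Fin d → ℝ) : piN σ u v n (-x) = -piN σ u v n x :=
  projHyp_neg _ _ _

/-- Unimodularity of the substitutions together with the positivity properties of the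
generalized eigenvectors that hold for primitive sequences. -/
structure HasPositiveEigenvectors (σ : ℤ → Substitution d) (u v : Fin d → ℝ) : Prop where
  unimodular : ∀ n, (σ n).IsUnimodular
  dotProduct_pos : 0 < u ⬝ᵥ v
  vVec_nonneg : ∀ n, 0 ≤ vVec (incSeq σ) v n

theorem TilingCondition.hasPositiveEigenvectors (h : TilingCondition σ u v)
    (hσ : ∀ n, (σ n).IsUnimodular) : HasPositiveEigenvectors σ u v where
  unimodular := hσ
  dotProduct_pos := dotProduct_pos_of_pos (h.right.pos h.primitive) h.left.1 h.left.2.1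
  vVec_nonneg := h.left.vVec_nonneg (isUnit_det_incSeq hσ) (incSeq_nonneg σ)

namespace HasPositiveEigenvectors

theorem isUnit_det (H : HasPositiveEigenvectors σ u v) (n : ℤ) : IsUnit (incSeq σ n).det :=
  isUnit_det_incSeq H.unimodular n

theorem uVec_dotProduct_pos (H : HasPositiveEigenvectors σ u v) (n : ℤ) :
    0 < uVec (incSeq σ) u n ⬝ᵥ vVec (incSeq σ) v n := by
  rw [uVec_dotProduct_vVec H.isUnit_det]
  exact H.dotProduct_pos

theorem uVec_dotProduct_ne_zero (H : HasPositiveEigenvectors σ u v) (n : ℤ) :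
    uVec (incSeq σ) u n ⬝ᵥ vVec (incSeq σ) v n ≠ 0 :=
  (H.uVec_dotProduct_pos n).ne'

theorem incSeq_mulVec_dotProduct (H : HasPositiveEigenvectors σ u v) (n : ℤ) (x : Fin d → ℝ) :
    (incSeq σ n *ᵥ x) ⬝ᵥ vVec (incSeq σ) v n = x ⬝ᵥ vVec (incSeq σ) v (n + 1) := by
  rw [mulVec_dotProduct_eq, vVec_succ H.isUnit_det]

theorem incSeq_mulVec_injective (H : HasPositiveEigenvectors σ u v) (n : ℤ) :
    Function.Injective (incSeq σ n).mulVec :=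
  Matrix.mulVec_injective_of_isUnit ((Matrix.isUnit_iff_isUnit_det _).mpr (H.isUnit_det n))

theorem incSeq_mulVec_inv (H : HasPositiveEigenvectors σ u v) (n : ℤ) (x : Fin d → ℝ) :
    incSeq σ n *ᵥ ((incSeq σ n)⁻¹ *ᵥ x) = x := by
  rw [Matrix.mulVec_mulVec, Matrix.mul_nonsing_inv _ (H.isUnit_det n), Matrix.one_mulVec]

theorem vVec_succ_apply (H : HasPositiveEigenvectors σ u v) (n : ℤ) (b : Fin d) :
    vVec (incSeq σ) v (n + 1) b =
      abel ((σ n).toEnd (FreeMonoid.of b)) ⬝ᵥ vVec (incSeq σ) v n := by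
  rw [← incSeq_mulVec_abel, H.incSeq_mulVec_dotProduct, abel_of, single_one_dotProduct]

theorem matProd_vVec_apply (H : HasPositiveEigenvectors σ u v) (n : ℤ) (k : ℕ) (b : Fin d) :
    vVec (incSeq σ) v (n + k) b =
      abel (substComp σ n k (FreeMonoid.of b)) ⬝ᵥ vVec (incSeq σ) v n := by
  rw [← matProd_mulVec_abel, matProd_mulVec_dotProduct_vVec H.isUnit_det, abel_of,
    single_one_dotProduct]

theorem piTildeN_mem_edge_iff (H : HasPositiveEigenvectors σ u v) (n : ℤ) (a : Fin d)
    (x : Fin d → ℝ) : piTildeN σ u v n x ∈ edge σ u v n a ↔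
      0 ≤ x ⬝ᵥ vVec (incSeq σ) v n ∧ x ⬝ᵥ vVec (incSeq σ) v n ≤ vVec (incSeq σ) v n a := by
  have hu := H.uVec_dotProduct_ne_zero n
  have hv := H.vVec_nonneg n a
  simp only [Pi.zero_apply] at hv
  constructor
  · rintro ⟨y, hy, hxy⟩
    rw [piTildeN, projLine_eq_iff hu] at hxy
    rw [segment_eq_image] at hy
    obtain ⟨t, ht, rfl⟩ := hy
    beta_reduce at hxy
    rw [← hxy, smul_zero, zero_add, smul_dotProduct, single_one_dotProduct, smul_eq_mul]
    exact ⟨mul_nonneg ht.1 hv, mul_le_of_le_one_left hv ht.2⟩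
  · rintro ⟨h0, h1⟩
    set s := x ⬝ᵥ vVec (incSeq σ) v n with hs
    refine ⟨(s / vVec (incSeq σ) v n a) • Pi.single a 1, ?_, ?_⟩
    · rw [segment_eq_image]
      exact ⟨s / vVec (incSeq σ) v n a, ⟨div_nonneg h0 hv, div_le_one_of_le₀ h1 hv⟩, by simp⟩
    · rw [piTildeN, projLine_eq_iff hu, smul_dotProduct, single_one_dotProduct, smul_eq_mul, ← hs]
      -- If `v_n(a) = 0`, the quotient is `0` by convention; the edge is the point `0`, and `s` is
      -- squeezed to `0` as well.
      rcases hv.eq_or_lt with h | h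
      · rw [← h] at h1 ⊢
        rw [mul_zero]
        linarith
      · field_simp

/-- The two coordinates of a box are independent. The sign of the second one comes from the
Minkowski difference. -/
theorem mem_edge_sub_iff (H : HasPositiveEigenvectors σ u v) {n : ℤ} {F : Set (Fin d → ℝ)}
    (hF : ∀ y ∈ F, y ⬝ᵥ vVec (incSeq σ) v n = 0) (a : Fin d) (x : Fin d → ℝ) :
    x ∈ edge σ u v n a - F ↔
      (0 ≤ x ⬝ᵥ vVec (incSeq σ) v n ∧ x ⬝ᵥ vVec (incSeq σ) v n ≤ vVec (incSeq σ) v n a) ∧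
        -piN σ u v n x ∈ F := by
  have hu := H.uVec_dotProduct_ne_zero n
  rw [← H.piTildeN_mem_edge_iff, Set.mem_sub]
  constructor
  · rintro ⟨y, hy, f, hf, rfl⟩
    obtain ⟨z, hz, rfl⟩ := hy
    have h1 : piTildeN σ u v n (piTildeN σ u v n z - f) = piTildeN σ u v n z := by
      unfold piTildeN
      rw [projLine_eq_iff hu, sub_dotProduct, hF f hf, sub_zero, projLine_dotProduct hu]
    refine ⟨by rw [h1]; exact Set.mem_image_of_mem _ hz, ?_⟩
    have h2 : piN σ u v n (piTildeN σ u v n z - f) = -f := by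
      rw [piN, projHyp_sub, projHyp_of_dotProduct_eq_zero (hF f hf), piTildeN, projLine,
        projHyp_smul_self hu, zero_sub]
    rwa [h2, neg_neg]
  · rintro ⟨h1, h2⟩
    refine ⟨_, h1, _, h2, ?_⟩
    rw [sub_neg_eq_add, add_comm]
    exact projHyp_add_projLine _ _ _

/-- The height is a linear form, nonzero because `u_n` has positive height, hence an open map, and
interiors commute with preimages. -/
theorem interior_strip (H : HasPositiveEigenvectors σ u v) (n : ℤ) (α β : ℝ) :
    interior {x : Fin d → ℝ | α ≤ x ⬝ᵥ vVec (incSeq σ) v n ∧ x ⬝ᵥ vVec (incSeq σ) v n ≤ β} =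
      {x : Fin d → ℝ | α < x ⬝ᵥ vVec (incSeq σ) v n ∧ x ⬝ᵥ vVec (incSeq σ) v n < β} := by
  have hu := H.uVec_dotProduct_ne_zero n
  let f : (Fin d → ℝ) →ₗ[ℝ] ℝ :=
    { toFun := fun x => x ⬝ᵥ vVec (incSeq σ) v n
      map_add' := fun x y => add_dotProduct _ _ _
      map_smul' := fun c x => smul_dotProduct _ _ _ }
  have hcont : Continuous f := f.continuous_of_finiteDimensional
  have hsurj : Function.Surjective f := fun t =>
    ⟨(t / (uVec (incSeq σ) u n ⬝ᵥ vVec (incSeq σ) v n)) • uVec (incSeq σ) u n, by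
      simp [f, hu]⟩
  have hopen : IsOpenMap f := f.isOpenMap_of_finiteDimensional hsurj
  have := hopen.preimage_interior_eq_interior_preimage hcont (Set.Icc α β)
  rw [interior_Icc] at this
  exact this.symm

/-- A box is the intersection of a strip and a cylinder in direction `u_n`, and interiors commute
with finite intersections. The interior of the cylinder stands for the relative interior of the
base. -/
theorem mem_interior_edge_sub_iff (H : HasPositiveEigenvectors σ u v) {n : ℤ}
    {F : Set (Fin d → ℝ)} (hF : ∀ y ∈ F, y ⬝ᵥ vVec (incSeq σ) v n = 0) (a : Fin d)
    (x : Fin d → ℝ) : x ∈ interior (edge σ u v n a - F) ↔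
      (0 < x ⬝ᵥ vVec (incSeq σ) v n ∧ x ⬝ᵥ vVec (incSeq σ) v n < vVec (incSeq σ) v n a) ∧
        x ∈ interior {x | -piN σ u v n x ∈ F} := by
  have h : edge σ u v n a - F = {x : Fin d → ℝ | 0 ≤ x ⬝ᵥ vVec (incSeq σ) v n ∧
      x ⬝ᵥ vVec (incSeq σ) v n ≤ vVec (incSeq σ) v n a} ∩ {x | -piN σ u v n x ∈ F} :=
    Set.ext fun x => H.mem_edge_sub_iff hF a x
  rw [h, interior_inter, H.interior_strip]
  rfl

theorem mem_interior_of_piN_eq {n : ℤ} {F : Set (Fin d → ℝ)} {x y : Fin d → ℝ}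
    (hxy : piN σ u v n x = piN σ u v n y) (hx : x ∈ interior {x | -piN σ u v n x ∈ F}) :
    y ∈ interior {x | -piN σ u v n x ∈ F} := by
  -- The vector `x - y` is parallel to `u_n`, so this translation preserves the cylinder.
  have hcont : Continuous fun z : Fin d → ℝ => z + (x - y) := by fun_prop
  have h1 : y ∈ (fun z : Fin d → ℝ => z + (x - y)) ⁻¹' interior {x | -piN σ u v n x ∈ F} := by
    simpa using hx
  refine interior_mono ?_ (preimage_interior_subset_interior_preimage hcont h1)
  intro z hz
  have h2 : piN σ u v n (z + (x - y)) = piN σ u v n z := by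
    rw [piN_add, piN_sub, hxy, sub_self, add_zero]
  simpa only [Set.mem_preimage, Set.mem_ofPred_eq, h2] using hz

/-- Exchanges the interior within `v_n^⊥` for the ambient interior of the cylinder over it, using
the continuous projection in one direction and restriction in the other. -/
theorem mem_relInterior_hyperplane_iff (H : HasPositiveEigenvectors σ u v) {n : ℤ}
    {F : Set (Fin d → ℝ)} {f : Fin d → ℝ} : f ∈ relInterior (hyperplane σ v n) F ↔
      f ⬝ᵥ vVec (incSeq σ) v n = 0 ∧ -f ∈ interior {x | -piN σ u v n x ∈ F} := by
  have hpi : ∀ z : Fin d → ℝ, z ⬝ᵥ vVec (incSeq σ) v n = 0 → -piN σ u v n (-z) = z := by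
    intro z hz
    rw [piN, projHyp_neg, neg_neg, projHyp_of_dotProduct_eq_zero hz]
  constructor
  · rintro ⟨⟨f, hf⟩, hfi, rfl⟩
    refine ⟨hf, ?_⟩
    obtain ⟨s, hs, hso, hfs⟩ := mem_interior.mp hfi
    obtain ⟨U, hU, rfl⟩ := isOpen_induced_iff.mp hso
    refine mem_interior.mpr ⟨{x | -piN σ u v n x ∈ U}, ?_, ?_, ?_⟩
    · intro x hx
      have hx0 : -piN σ u v n x ∈ hyperplane σ v n := by
        change (-piN σ u v n x) ⬝ᵥ _ = 0
        rw [neg_dotProduct, piN, projHyp_dotProduct (H.uVec_dotProduct_ne_zero n), neg_zero]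
      exact hs (a := ⟨_, hx0⟩) hx
    · exact hU.preimage (continuous_projHyp _ _).neg
    · change -piN σ u v n (-f) ∈ U
      rw [hpi f hf]
      exact hfs
  · rintro ⟨hf, hfi⟩
    refine ⟨⟨f, hf⟩, mem_interior.mpr
      ⟨Subtype.val ⁻¹' (Neg.neg ⁻¹' interior {x | -piN σ u v n x ∈ F}), ?_, ?_, hfi⟩, rfl⟩
    · rintro ⟨z, hz⟩ hzi
      have := interior_subset hzi
      rw [Set.mem_ofPred_eq, hpi z hz] at this
      exact this
    · exact (isOpen_interior.preimage continuous_neg).preimage continuous_subtype_val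

theorem mem_relInterior_line_iff (H : HasPositiveEigenvectors σ u v) {n : ℤ} {a : Fin d}
    {f : Fin d → ℝ} : f ∈ relInterior (line σ u n) (edge σ u v n a) ↔
      f ∈ line σ u n ∧ 0 < f ⬝ᵥ vVec (incSeq σ) v n ∧
        f ⬝ᵥ vVec (incSeq σ) v n < vVec (incSeq σ) v n a := by
  have hpi : ∀ z ∈ line σ u n, piTildeN σ u v n z = z := by
    rintro _ ⟨t, rfl⟩
    simp [piTildeN, projLine, smul_dotProduct, H.uVec_dotProduct_ne_zero n]
  constructor
  · rintro ⟨⟨f, hf⟩, hfi, rfl⟩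
    refine ⟨hf, ?_⟩
    obtain ⟨s, hs, hso, hfs⟩ := mem_interior.mp hfi
    obtain ⟨U, hU, rfl⟩ := isOpen_induced_iff.mp hso
    have h1 : f ∈ interior {x : Fin d → ℝ | 0 ≤ x ⬝ᵥ vVec (incSeq σ) v n ∧
        x ⬝ᵥ vVec (incSeq σ) v n ≤ vVec (incSeq σ) v n a} := by
      refine mem_interior.mpr ⟨{x | piTildeN σ u v n x ∈ U}, ?_, ?_, ?_⟩
      · intro x hx
        exact (H.piTildeN_mem_edge_iff n a x).mp (hs (a := ⟨_, ⟨_, rfl⟩⟩) hx)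
      · exact hU.preimage (continuous_projLine _ _)
      · change piTildeN σ u v n f ∈ U
        rw [hpi f hf]
        exact hfs
    rwa [H.interior_strip] at h1
  · rintro ⟨hf, hfi⟩
    rw [← Set.mem_ofPred_eq (p := fun f : Fin d → ℝ => 0 < f ⬝ᵥ vVec (incSeq σ) v n ∧
      f ⬝ᵥ vVec (incSeq σ) v n < vVec (incSeq σ) v n a), ← H.interior_strip] at hfi
    refine ⟨⟨f, hf⟩, mem_interior.mpr ⟨Subtype.val ⁻¹' _, ?_,
      isOpen_interior.preimage continuous_subtype_val, hfi⟩, rfl⟩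
    rintro ⟨z, hz⟩ hzi
    have := (H.piTildeN_mem_edge_iff n a z).mpr (interior_subset (s := {x : Fin d → ℝ |
      0 ≤ x ⬝ᵥ vVec (incSeq σ) v n ∧ x ⬝ᵥ vVec (incSeq σ) v n ≤ vVec (incSeq σ) v n a}) hzi)
    rwa [hpi z hz] at this

end HasPositiveEigenvectors

end Boxes

/-! ### Refined boxes, uniqueness of lifts, and the topological partition. -/

section FineBoxes

variable {d : ℕ} {σ : ℤ → Substitution d} {u v : Fin d → ℝ}

theorem prefixOf_edge_substComp (n : ℤ) (e : Edges σ n) :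
    PrefixOf (e.1.2.1 * FreeMonoid.of e.1.1) (substComp σ n 1 (FreeMonoid.of e.1.2.2)) := by
  rw [substComp_one]
  exact e.2

namespace HasPositiveEigenvectors

theorem fineFractal_subset (H : HasPositiveEigenvectors σ u v) (n : ℤ) (e : Edges σ n) :
    fineFractal σ u v n e ⊆ rauzySubtile σ u v n (FreeMonoid.of e.1.1) := by
  rintro _ ⟨_, rfl, _, ⟨x, hx, rfl⟩, rfl⟩
  have := piN_add_matProd_mulVec_mem_rauzySubtile H.unimodular u v
    (prefixOf_edge_substComp n e) (x := x) (by simpa using hx)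
  rwa [matProd_one] at this

theorem rauzySubtile_dotProduct (H : HasPositiveEigenvectors σ u v) (n : ℤ)
    (w : FreeMonoid (Fin d)) :
    ∀ y ∈ rauzySubtile σ u v n w, y ⬝ᵥ vVec (incSeq σ) v n = 0 :=
  fun _ hy => rauzySubtile_dotProduct_vVec H.unimodular H.dotProduct_pos.ne' hy

theorem fineFractal_dotProduct (H : HasPositiveEigenvectors σ u v) (n : ℤ) (e : Edges σ n) :
    ∀ y ∈ fineFractal σ u v n e, y ⬝ᵥ vVec (incSeq σ) v n = 0 :=
  fun _ hy => H.rauzySubtile_dotProduct n _ _ (H.fineFractal_subset n e hy)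

theorem mem_rauzyBox_iff (H : HasPositiveEigenvectors σ u v) {n : ℤ} {a : Fin d}
    {x : Fin d → ℝ} : x ∈ rauzyBox σ u v n a ↔
      (0 ≤ x ⬝ᵥ vVec (incSeq σ) v n ∧ x ⬝ᵥ vVec (incSeq σ) v n ≤ vVec (incSeq σ) v n a) ∧
        -piN σ u v n x ∈ rauzySubtile σ u v n (FreeMonoid.of a) :=
  H.mem_edge_sub_iff (H.rauzySubtile_dotProduct n _) a x

theorem mem_fineBox_iff (H : HasPositiveEigenvectors σ u v) {n : ℤ} {e : Edges σ n}
    {x : Fin d → ℝ} : x ∈ fineBox σ u v n e ↔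
      (0 ≤ x ⬝ᵥ vVec (incSeq σ) v n ∧ x ⬝ᵥ vVec (incSeq σ) v n ≤ vVec (incSeq σ) v n e.1.1) ∧
        -piN σ u v n x ∈ fineFractal σ u v n e :=
  H.mem_edge_sub_iff (H.fineFractal_dotProduct n e) e.1.1 x

theorem mem_interior_fineBox_iff (H : HasPositiveEigenvectors σ u v) {n : ℤ} {e : Edges σ n}
    {x : Fin d → ℝ} : x ∈ interior (fineBox σ u v n e) ↔
      (0 < x ⬝ᵥ vVec (incSeq σ) v n ∧ x ⬝ᵥ vVec (incSeq σ) v n < vVec (incSeq σ) v n e.1.1) ∧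
        x ∈ interior {x | -piN σ u v n x ∈ fineFractal σ u v n e} :=
  H.mem_interior_edge_sub_iff (H.fineFractal_dotProduct n e) e.1.1 x

theorem fineBox_subset_rauzyBox (H : HasPositiveEigenvectors σ u v) (n : ℤ) (e : Edges σ n) :
    fineBox σ u v n e ⊆ rauzyBox σ u v n e.1.1 :=
  Set.sub_subset_sub_left (H.fineFractal_subset n e)

/-- Ensures that the slab belonging to `a` after `p` does not exceed the height of the box of `b`.
-/
theorem abel_add_vVec_le (H : HasPositiveEigenvectors σ u v) (n : ℤ) (e : Edges σ n) :
    abel e.1.2.1 ⬝ᵥ vVec (incSeq σ) v n + vVec (incSeq σ) v n e.1.1 ≤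
      vVec (incSeq σ) v (n + 1) e.1.2.2 := by
  have := abel_dotProduct_le_of_prefixOf (H.vVec_nonneg n) e.2
  rwa [abel_mul, abel_of, add_dotProduct, single_one_dotProduct, ← H.vVec_succ_apply] at this

theorem abel_dotProduct_nonneg (H : HasPositiveEigenvectors σ u v) (n : ℤ)
    (p : FreeMonoid (Fin d)) : 0 ≤ abel p ⬝ᵥ vVec (incSeq σ) v n :=
  dotProduct_nonneg_of_nonneg (fun _ => Nat.cast_nonneg _) (H.vVec_nonneg n)

/-- Membership in `R_n(a,p,b)` in terms of the coordinates of the level `n + 1`. -/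
theorem neg_piN_mem_fineFractal_iff (H : HasPositiveEigenvectors σ u v) {n : ℤ} {e : Edges σ n}
    {x y : Fin d → ℝ} (h : incSeq σ n *ᵥ y = x + abel e.1.2.1) :
    -piN σ u v n x ∈ fineFractal σ u v n e ↔
      -piN σ u v (n + 1) y ∈ rauzySubtile σ u v (n + 1) (FreeMonoid.of e.1.2.2) := by
  have hx : -piN σ u v n x =
      piN σ u v n (abel e.1.2.1) + incSeq σ n *ᵥ (-piN σ u v (n + 1) y) := by
    rw [Matrix.mulVec_neg, ← piN_incSeq_mulVec H.unimodular, h, piN_add]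
    abel
  rw [hx, fineFractal]
  constructor
  · rintro ⟨_, rfl, _, ⟨z, hz, rfl⟩, hzy⟩
    rwa [← H.incSeq_mulVec_injective n (add_left_cancel hzy)]
  · exact fun hy => ⟨_, rfl, _, ⟨_, hy, rfl⟩, rfl⟩

theorem incSeq_mulVec_dotProduct_of_eq (H : HasPositiveEigenvectors σ u v) {n : ℤ}
    {p : FreeMonoid (Fin d)} {x y : Fin d → ℝ} (h : incSeq σ n *ᵥ y = x + abel p) :
    y ⬝ᵥ vVec (incSeq σ) v (n + 1) =
      x ⬝ᵥ vVec (incSeq σ) v n + abel p ⬝ᵥ vVec (incSeq σ) v n := by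
  rw [← H.incSeq_mulVec_dotProduct, h, add_dotProduct]

/-- In the coordinates of level `n + 1` the base becomes `R_{n+1}(b)`, and heights are raised by the
height of `ℓ(p)`. -/
theorem mem_rauzyBox_of_mem_fineBox (H : HasPositiveEigenvectors σ u v) {n : ℤ} {e : Edges σ n}
    {x y : Fin d → ℝ} (h : incSeq σ n *ᵥ y = x + abel e.1.2.1) (hx : x ∈ fineBox σ u v n e) :
    y ∈ rauzyBox σ u v (n + 1) e.1.2.2 := by
  rw [H.mem_fineBox_iff, H.neg_piN_mem_fineFractal_iff h] at hx
  rw [H.mem_rauzyBox_iff, H.incSeq_mulVec_dotProduct_of_eq h]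
  have h1 := H.abel_add_vVec_le n e
  have h2 := H.abel_dotProduct_nonneg n e.1.2.1
  exact ⟨⟨by linarith [hx.1.1], by linarith [hx.1.2]⟩, hx.2⟩

theorem mem_interior_rauzyBox_of_mem_interior_fineBox (H : HasPositiveEigenvectors σ u v) {n : ℤ}
    {e : Edges σ n} {x y : Fin d → ℝ} (h : incSeq σ n *ᵥ y = x + abel e.1.2.1)
    (hx : x ∈ interior (fineBox σ u v n e)) : y ∈ interior (rauzyBox σ u v (n + 1) e.1.2.2) := by
  have hcont : Continuous fun z : Fin d → ℝ => incSeq σ n *ᵥ z - abel e.1.2.1 := by fun_prop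
  have h1 : y ∈ (fun z : Fin d → ℝ => incSeq σ n *ᵥ z - abel e.1.2.1) ⁻¹'
      interior (fineBox σ u v n e) := by
    simpa [h] using hx
  refine interior_mono ?_ (preimage_interior_subset_interior_preimage hcont h1)
  exact fun z hz => H.mem_rauzyBox_of_mem_fineBox (by simp) hz

/-- Otherwise the interiors of two different tiles would meet in a nonempty open set, which has
positive measure. -/
theorem eq_of_mem_interior_rauzyBox (ht : TilingCondition σ u v) {n : ℤ} {a b : Fin d}
    {x y : Fin d → ℝ} {k : Fin d → ℤ} (hx : x ∈ interior (rauzyBox σ u v n a))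
    (hy : y ∈ interior (rauzyBox σ u v n b)) (hxy : x = y + intVec k) : a = b ∧ x = y := by
  have key : ((0 : Fin d → ℤ), a) = (k, b) := by
    by_contra hne
    have h0 := (ht.tiling n).disjoint _ _ hne
    set U := interior (rauzyBox σ u v n a) ∩
      (fun z => z - intVec k) ⁻¹' interior (rauzyBox σ u v n b) with hU
    have hUo : IsOpen U := isOpen_interior.inter (isOpen_interior.preimage (by fun_prop))
    have hUx : x ∈ U := ⟨hx, by simpa [hxy] using hy⟩
    have hsub : U ⊆ ({fun i => (((0 : Fin d → ℤ) i : ℤ) : ℝ)} + rauzyBox σ u v n a) ∩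
        ({fun i => (k i : ℝ)} + rauzyBox σ u v n b) := by
      rintro z ⟨hz1, hz2⟩
      refine ⟨⟨_, rfl, z, interior_subset hz1, ?_⟩, ⟨_, rfl, _, interior_subset hz2, ?_⟩⟩
      · funext i
        simp
      · funext i
        simp [intVec]
    have h1 := hUo.measure_eq_zero_iff MeasureTheory.volume |>.mp
      (MeasureTheory.measure_mono_null hsub h0)
    rw [h1] at hUx
    exact hUx
  simp only [Prod.mk.injEq] at key
  obtain ⟨rfl, rfl⟩ := key
  exact ⟨rfl, by rw [hxy]; funext i; simp [intVec]⟩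

/-- By unimodularity, `y` and the canonical image `z` of `x` differ by an integer vector; both lie
in interiors of boxes of level `n + 1`, so they coincide. The unknown lattice vector `k` is thereby
identified with `ℓ(p)`. -/
theorem eq_of_mem_interior_fineBox_of_mem_interior_rauzyBox (H : HasPositiveEigenvectors σ u v)
    (ht : TilingCondition σ u v) {n : ℤ} {e : Edges σ n} {b : Fin d} {x y : Fin d → ℝ}
    {k : Fin d → ℤ} (hx : x ∈ interior (fineBox σ u v n e))
    (hy : y ∈ interior (rauzyBox σ u v (n + 1) b)) (hxy : incSeq σ n *ᵥ y = x + intVec k) :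
    b = e.1.2.2 ∧ incSeq σ n *ᵥ y = x + abel e.1.2.1 := by
  set z := (incSeq σ n)⁻¹ *ᵥ (x + abel e.1.2.1)
  have hz : incSeq σ n *ᵥ z = x + abel e.1.2.1 := H.incSeq_mulVec_inv n _
  have hzi := H.mem_interior_rauzyBox_of_mem_interior_fineBox hz hx
  have h1 : incSeq σ n *ᵥ (y - z) = intVec (k - fun a => (occ e.1.2.1 a : ℤ)) := by
    rw [Matrix.mulVec_sub, hxy, hz, intVec_sub, intVec_occ]
    abel
  obtain ⟨l, hl⟩ := exists_eq_intVec_of_mulVec (H.unimodular n) h1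
  obtain ⟨h2, h3⟩ := eq_of_mem_interior_rauzyBox ht hy hzi (k := l) (by rw [← hl]; abel)
  exact ⟨h2, h3 ▸ hz⟩

theorem eq_of_mem_interior_fineBox (H : HasPositiveEigenvectors σ u v)
    (ht : TilingCondition σ u v) {n : ℤ} {e e' : Edges σ n} {x y : Fin d → ℝ}
    {k : Fin d → ℤ} (hx : x ∈ interior (fineBox σ u v n e))
    (hy : y ∈ interior (fineBox σ u v n e')) (hxy : x = y + intVec k) : e = e' ∧ x = y := by
  set z := (incSeq σ n)⁻¹ *ᵥ (x + abel e.1.2.1)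
  have hz : incSeq σ n *ᵥ z = x + abel e.1.2.1 := H.incSeq_mulVec_inv n _
  have hzi := H.mem_interior_rauzyBox_of_mem_interior_fineBox hz hx
  obtain ⟨hb, hz'⟩ := H.eq_of_mem_interior_fineBox_of_mem_interior_rauzyBox ht hy hzi
    (k := k + fun a => (occ e.1.2.1 a : ℤ)) (by
      rw [hz, hxy, intVec_add, intVec_occ]
      abel)
  have hx1 := (H.mem_interior_fineBox_iff.mp hx).1
  have hy1 := (H.mem_interior_fineBox_iff.mp hy).1
  have hzx := H.incSeq_mulVec_dotProduct_of_eq hz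
  have hzy := H.incSeq_mulVec_dotProduct_of_eq hz'
  have hlt : ∀ {p q : FreeMonoid (Fin d)} {a : Fin d}, PrefixOf (p * FreeMonoid.of a) q →
      abel p ⬝ᵥ vVec (incSeq σ) v n + vVec (incSeq σ) v n a ≤
        abel q ⬝ᵥ vVec (incSeq σ) v n := by
    intro p q a h
    have := abel_dotProduct_le_of_prefixOf (H.vVec_nonneg n) h
    rwa [abel_mul, abel_of, add_dotProduct, single_one_dotProduct] at this
  obtain ⟨⟨a, p, b⟩, he⟩ := e
  obtain ⟨⟨a', p', b'⟩, he'⟩ := e'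
  dsimp only at hb he he' hx1 hy1 hzx hzy
  subst hb
  -- Both `x` and `y` are moved to the same `z`, whose height lies strictly inside the slab of `p a`
  -- and strictly inside that of `p' a'` in the broken line of `σ_n(b)`. Slabs of different
  -- occurrences do not overlap.
  rcases he.mul_of_trichotomy he' with ⟨rfl, rfl⟩ | h | h
  · exact ⟨rfl, add_right_cancel (hz.symm.trans hz')⟩
  · linarith [hlt h]
  · linarith [hlt h]

theorem exists_mem_fineBox (H : HasPositiveEigenvectors σ u v) (ht : TilingCondition σ u v)
    (n : ℤ) (z : Fin d → ℝ) : ∃ (k : Fin d → ℤ) (e : Edges σ n),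
      z - intVec k ∈ fineBox σ u v n e := by
  -- Covering comes from level `n + 1`: the tile containing `M_{σ_n}⁻¹ z` is cut into slabs by the
  -- letters of `σ_n(b)`. The decomposition of `R_n(a)` into the sets `R_n(a,p,b)` is not required.
  have hcov : (incSeq σ n)⁻¹ *ᵥ z ∈ (Set.univ : Set (Fin d → ℝ)) := Set.mem_univ _
  rw [← (ht.tiling (n + 1)).cover] at hcov
  obtain ⟨⟨m, b⟩, _, rfl, y, hy, hyz⟩ := Set.mem_iUnion.mp hcov
  have hz : z = incSeq σ n *ᵥ intVec m + incSeq σ n *ᵥ y := by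
    rw [← Matrix.mulVec_add, ← H.incSeq_mulVec_inv n z, ← hyz]
    rfl
  have hy' := H.mem_rauzyBox_iff.mp hy
  rw [← H.incSeq_mulVec_dotProduct, H.vVec_succ_apply] at hy'
  obtain ⟨p, a, hp, h1, h2⟩ := exists_prefixOf_dotProduct_le _
    ((σ n).nonerasing b) hy'.1.1 hy'.1.2
  obtain ⟨e, he⟩ : ∃ e : Edges σ n, e.1 = (a, p, b) := ⟨⟨(a, p, b), hp⟩, rfl⟩
  refine ⟨(σ n).incidence *ᵥ m + fun a => (occ p a : ℤ), e, ?_⟩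
  have h3 : z - intVec ((σ n).incidence *ᵥ m + fun a => (occ p a : ℤ)) =
      incSeq σ n *ᵥ y - abel p := by
    rw [intVec_add, intVec_mulVec, intVec_occ, hz, incSeq]
    abel
  rw [h3, H.mem_fineBox_iff, H.neg_piN_mem_fineFractal_iff (y := y) (by simp [he]), sub_dotProduct, he]
  exact ⟨⟨by linarith, by dsimp only; linarith⟩, hy'.2⟩

theorem isCompact_edge (σ : ℤ → Substitution d) (u v : Fin d → ℝ) (n : ℤ) (a : Fin d) :
    IsCompact (edge σ u v n a) := by
  refine IsCompact.image ?_ (continuous_projLine _ _)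
  rw [segment_eq_image]
  exact isCompact_Icc.image (by fun_prop)

theorem isCompact_rauzyBox (hc : ∀ n, IsCompact (rauzyFractal σ u v n)) (n : ℤ) (a : Fin d) :
    IsCompact (rauzyBox σ u v n a) := by
  rw [rauzyBox, sub_eq_add_neg]
  exact (isCompact_edge σ u v n a).add (isCompact_rauzySubtile hc _ _).neg

theorem isCompact_fineBox (hc : ∀ n, IsCompact (rauzyFractal σ u v n)) (n : ℤ) (e : Edges σ n) :
    IsCompact (fineBox σ u v n e) := by
  rw [fineBox, sub_eq_add_neg]
  exact (isCompact_edge σ u v n e.1.1).add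
    (isCompact_singleton.add ((isCompact_rauzySubtile hc _ _).image (by fun_prop))).neg

theorem isTopologicalPartition_finePartition (H : HasPositiveEigenvectors σ u v)
    (ht : TilingCondition σ u v) (hc : ∀ n, IsCompact (rauzyFractal σ u v n)) (n : ℤ) :
    IsTopologicalPartition (finePartition σ u v n) where
  finite := finite_edges σ n
  isOpen _ := isOpenMap_torusMk _ isOpen_interior
  disjoint e e' hne := by
    rw [Set.disjoint_left]
    rintro _ ⟨x, hx, rfl⟩ ⟨y, hy, hxy⟩
    obtain ⟨k, hk⟩ := torusMk_eq_iff.mp hxy.symm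
    exact hne (H.eq_of_mem_interior_fineBox ht hx hy hk).1
  cover := by
    have := finite_edges σ n
    rw [← closure_iUnion_of_finite, ← dense_iff_closure_eq]
    let f : (Fin d → ℤ) × Edges σ n → Set (Fin d → ℝ) := fun ke =>
      (fun z => z - intVec ke.1) ⁻¹' fineBox σ u v n ke.2
    have hcov : ⋃ ke, f ke = Set.univ := by
      refine Set.eq_univ_of_forall fun z => Set.mem_iUnion.mpr ?_
      obtain ⟨k, e, h⟩ := H.exists_mem_fineBox ht n z
      exact ⟨(k, e), h⟩
    -- Baire: countably many closed sets cover `ℝ^d`, so the union of their interiors is dense.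
    have hdense := dense_iUnion_interior_of_closed (f := f)
      (fun ke => (isCompact_fineBox hc n ke.2).isClosed.preimage (by fun_prop)) hcov
    refine (torusMk_surjective.denseRange.dense_image continuous_torusMk hdense).mono ?_
    rintro _ ⟨x, hx, rfl⟩
    obtain ⟨⟨k, e⟩, hx⟩ := Set.mem_iUnion.mp hx
    refine Set.mem_iUnion.mpr ⟨e, x - intVec k, ?_, ?_⟩
    · have hcont : Continuous fun z : Fin d → ℝ => z + intVec k := by fun_prop
      refine interior_mono ?_ (preimage_interior_subset_interior_preimage hcont
        (show x - intVec k ∈ (fun z => z + intVec k) ⁻¹' interior (f (k, e)) by simpa using hx))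
      intro z hz
      simpa [f] using hz
    · exact (torusMk_eq_iff.mpr ⟨k, by simp⟩).symm

end HasPositiveEigenvectors

end FineBoxes

/-! ### Property M implies the Markov property, for general mapping families. -/

section PropertyMImpliesMarkov

variable {X : ℤ → Type*} {ι : ℤ → Type*}

theorem mem_atom_iff {R : ∀ n, ι n → Set (X n)} {i : ∀ n, ι n} {k : ℤ} {s : Σ n, X n} :
    s ∈ atom R k (i k) ↔ s.1 = k ∧ s.2 ∈ R s.1 (i s.1) := by
  constructor
  · rintro ⟨x, hx, rfl⟩
    exact ⟨rfl, hx⟩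
  · rintro ⟨rfl, h⟩
    exact ⟨s.2, h, rfl⟩

/-- The points of the disjoint union that lie in the atoms selected by `i`. -/
def atomUnion (R : ∀ n, ι n → Set (X n)) (i : ∀ n, ι n) : Set (Σ n, X n) :=
  {s | s.2 ∈ R s.1 (i s.1)}

/-- The vertical atom through a point of the disjoint union. -/
def sigmaVertical (v : ∀ n, ι n → X n → Set (X n)) (i : ∀ n, ι n) (s : Σ n, X n) :
    Set (Σ n, X n) :=
  Sigma.mk s.1 '' v s.1 (i s.1) s.2

variable [∀ n, TopologicalSpace (X n)]

theorem totalMap_fst (f : ∀ n, X n ≃ₜ X (n + 1)) (s : Σ n, X n) : (totalMap f s).1 = s.1 + 1 :=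
  rfl

theorem totalMap_pow_fst (f : ∀ n, X n ≃ₜ X (n + 1)) (j : ℕ) (s : Σ n, X n) :
    ((totalMap f ^ j) s).1 = s.1 + j := by
  induction j with
  | zero => simp
  | succ j ih =>
    rw [pow_succ', Equiv.Perm.mul_apply, totalMap_fst, ih]
    push_cast
    ring

theorem PropertyM.sigmaVertical_subset {f : ∀ n, X n ≃ₜ X (n + 1)} {R : ∀ n, ι n → Set (X n)}
    {h v : ∀ n, ι n → X n → Set (X n)} (hM : PropertyM f R h v) {i : ∀ n, ι n} {s : Σ n, X n}
    (hs : s ∈ atomUnion R i) : sigmaVertical v i s ⊆ atomUnion R i := by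
  rintro _ ⟨x, hx, rfl⟩
  exact (hM.transverse _ _).v_subset _ hs hx

theorem PropertyM.totalMap_mem_sigmaVertical {f : ∀ n, X n ≃ₜ X (n + 1)}
    {R : ∀ n, ι n → Set (X n)} {h v : ∀ n, ι n → X n → Set (X n)} (hM : PropertyM f R h v)
    {i : ∀ n, ι n} {s t : Σ n, X n} (hs : s ∈ atomUnion R i) (hfs : totalMap f s ∈ atomUnion R i)
    (ht : t ∈ sigmaVertical v i s) : totalMap f t ∈ sigmaVertical v i (totalMap f s) := by
  obtain ⟨x, hx, rfl⟩ := ht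
  obtain ⟨n, s⟩ := s
  have := hM.vertical n (i n) (i (n + 1)) (f n s) ⟨⟨s, hs, rfl⟩, hfs⟩
  rw [Homeomorph.symm_apply_apply] at this
  exact ⟨f n x, this ⟨x, hx, rfl⟩, rfl⟩

/-- A point whose orbit follows an admissible finite itinerary. -/
theorem PropertyM.exists_orbit {f : ∀ n, X n ≃ₜ X (n + 1)} {R : ∀ n, ι n → Set (X n)}
    {h v : ∀ n, ι n → X n → Set (X n)} (hM : PropertyM f R h v) (i : ∀ n, ι n) (m : ℕ) (n : ℤ)
    (hi : ∀ k : ℤ, n ≤ k → k < n + (m + 1 : ℕ) →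
      ∃ q, q.1 = k ∧ q ∈ atomUnion R i ∧ totalMap f q ∈ atomUnion R i) :
    ∃ s : Σ n, X n, s.1 = n ∧ ∀ j ≤ m + 1, (totalMap f ^ j) s ∈ atomUnion R i := by
  induction m generalizing n with
  | zero =>
    obtain ⟨q, hq, h1, h2⟩ := hi n le_rfl (by simp)
    refine ⟨q, hq, fun j hj => ?_⟩
    interval_cases j
    · exact h1
    · exact h2
  | succ m ih =>
    obtain ⟨s, hs, hsj⟩ := ih (n + 1) fun k hk hk' =>
      hi k (by omega) (by push_cast at hk' ⊢; omega)
    obtain ⟨⟨n', q⟩, rfl, hq, hfq⟩ := hi n le_rfl (by push_cast; omega)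
    obtain ⟨n'', s⟩ := s
    obtain rfl : n'' = n' + 1 := hs
    -- The splice: `r` lies on the horizontal atom of `f q`, so it pulls back into the atom of `q`,
    -- and on the vertical atom of `s`, so its future shadows that of `s`.
    obtain ⟨r, hrh, hrv⟩ := (hM.transverse _ _).transverse (f n' q) hfq s (hsj 0 (by omega))
    obtain ⟨r', hr', rfl⟩ := hM.horizontal n' _ _ (f n' q) ⟨⟨q, hq, rfl⟩, hfq⟩ hrh
    rw [Homeomorph.symm_apply_apply] at hr'
    have key : ∀ j ≤ m + 1, (totalMap f ^ j) ⟨n' + 1, f n' r'⟩ ∈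
        sigmaVertical v i ((totalMap f ^ j) ⟨n' + 1, s⟩) := by
      intro j hj
      induction j with
      | zero => exact ⟨_, hrv, rfl⟩
      | succ j ihj =>
        have h3 := hsj (j + 1) hj
        rw [pow_succ', Equiv.Perm.mul_apply] at h3 ⊢
        exact hM.totalMap_mem_sigmaVertical (hsj j (by omega)) h3 (ihj (by omega))
    refine ⟨⟨n', r'⟩, rfl, fun j hj => ?_⟩
    cases j with
    | zero => exact (hM.transverse _ _).h_subset q hq hr'
    | succ j =>
      rw [pow_succ, Equiv.Perm.mul_apply]
      exact hM.sigmaVertical_subset (hsj j (by omega)) (key j (by omega))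

theorem PropertyM.isMarkovPartition {f : ∀ n, X n ≃ₜ X (n + 1)} {R : ∀ n, ι n → Set (X n)}
    {h v : ∀ n, ι n → X n → Set (X n)} (hM : PropertyM f R h v) : IsMarkovPartition f R where
  partition := hM.partition
  markov i n m hm hi := by
    obtain ⟨m, rfl⟩ : ∃ l, m = l + 1 := ⟨m - 1, by omega⟩
    obtain ⟨s, hs, hsj⟩ := hM.exists_orbit i m n fun k hk hk' => by
      obtain ⟨q, hq, hfq⟩ := hi k hk hk'
      exact ⟨q, (mem_atom_iff.mp hq).1, (mem_atom_iff.mp hq).2, (mem_atom_iff.mp hfq).2⟩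
    refine ⟨s, Set.mem_iInter₂.mpr fun j hj => ?_⟩
    rw [Finset.mem_range] at hj
    exact mem_atom_iff.mpr ⟨by rw [totalMap_pow_fst, hs], hsj j (by omega)⟩

end PropertyMImpliesMarkov

/-! ### Property M for the refined Rauzy boxes. -/

section RauzyPropertyM

variable {d : ℕ} {σ : ℤ → Substitution d} {u v : Fin d → ℝ}

namespace HasPositiveEigenvectors

/-- Together with `singleton_add_relInterior`, this turns the atoms into the fibres of the two
coordinates, height and `π_n`, on the interior of the box. -/
theorem singleton_sub_relInterior (H : HasPositiveEigenvectors σ u v) {n : ℤ} {e : Edges σ n}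
    {x : Fin d → ℝ} (hx : x ∈ interior (fineBox σ u v n e)) :
    {piTildeN σ u v n x} - relInterior (hyperplane σ v n) (fineFractal σ u v n e) =
      {y ∈ interior (fineBox σ u v n e) |
        y ⬝ᵥ vVec (incSeq σ) v n = x ⬝ᵥ vVec (incSeq σ) v n} := by
  have hu := H.uVec_dotProduct_ne_zero n
  ext y
  constructor
  · rintro ⟨_, rfl, f, hf, rfl⟩
    rw [H.mem_relInterior_hyperplane_iff] at hf
    have h1 : (piTildeN σ u v n x - f) ⬝ᵥ vVec (incSeq σ) v n = x ⬝ᵥ vVec (incSeq σ) v n := by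
      rw [sub_dotProduct, hf.1, sub_zero]
      exact projLine_dotProduct hu x
    refine ⟨H.mem_interior_fineBox_iff.mpr ⟨?_, mem_interior_of_piN_eq ?_ hf.2⟩, h1⟩
    · change _ < (piTildeN σ u v n x - f) ⬝ᵥ _ ∧ (piTildeN σ u v n x - f) ⬝ᵥ _ < _
      rw [h1]
      exact (H.mem_interior_fineBox_iff.mp hx).1
    · change _ = piN σ u v n (piTildeN σ u v n x - f)
      rw [piN_sub, piN_neg, eq_comm, sub_eq_neg_self]
      exact projHyp_smul_self hu _
  · rintro ⟨hy, hyx⟩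
    refine ⟨_, rfl, -piN σ u v n y, ?_, ?_⟩
    · rw [H.mem_relInterior_hyperplane_iff, neg_neg, neg_dotProduct]
      refine ⟨neg_eq_zero.mpr (projHyp_dotProduct hu y),
        mem_interior_of_piN_eq ?_ (H.mem_interior_fineBox_iff.mp hy).2⟩
      exact (projHyp_of_dotProduct_eq_zero (projHyp_dotProduct hu y)).symm
    · change piTildeN σ u v n x - -piN σ u v n y = y
      rw [show piTildeN σ u v n x = piTildeN σ u v n y from ((projLine_eq_iff hu).mpr hyx).symm,
        sub_neg_eq_add, add_comm]
      exact projHyp_add_projLine _ _ _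

theorem singleton_add_relInterior (H : HasPositiveEigenvectors σ u v) {n : ℤ} {e : Edges σ n}
    {x : Fin d → ℝ} (hx : x ∈ interior (fineBox σ u v n e)) :
    {piN σ u v n x} + relInterior (line σ u n) (edge σ u v n e.1.1) =
      {y ∈ interior (fineBox σ u v n e) | piN σ u v n y = piN σ u v n x} := by
  have hu := H.uVec_dotProduct_ne_zero n
  ext y
  constructor
  · rintro ⟨_, rfl, f, hf, rfl⟩
    rw [H.mem_relInterior_line_iff] at hf
    obtain ⟨⟨t, rfl⟩, hf⟩ := hf
    have h1 : piN σ u v n (piN σ u v n x + t • uVec (incSeq σ) u n) = piN σ u v n x := by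
      rw [piN_add]
      conv_rhs => rw [← add_zero (piN σ u v n x)]
      congr 1
      · exact projHyp_of_dotProduct_eq_zero (projHyp_dotProduct hu _)
      · exact projHyp_smul_self hu _
    refine ⟨H.mem_interior_fineBox_iff.mpr
      ⟨?_, mem_interior_of_piN_eq h1.symm (H.mem_interior_fineBox_iff.mp hx).2⟩, h1⟩
    change _ < (piN σ u v n x + t • uVec (incSeq σ) u n) ⬝ᵥ _ ∧
      (piN σ u v n x + t • uVec (incSeq σ) u n) ⬝ᵥ _ < _
    rwa [add_dotProduct, piN, projHyp_dotProduct hu, zero_add]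
  · rintro ⟨hy, hyx⟩
    refine ⟨_, rfl, piTildeN σ u v n y, ?_, ?_⟩
    · rw [H.mem_relInterior_line_iff, piTildeN, projLine_dotProduct hu]
      exact ⟨⟨_, rfl⟩, (H.mem_interior_fineBox_iff.mp hy).1⟩
    · change piN σ u v n x + piTildeN σ u v n y = y
      rw [← hyx]
      exact projHyp_add_projLine _ _ _

/-- A point of the torus has only one lift in the interior of a given box, so the union over lifts
has a single term. -/
theorem biUnion_lifts (H : HasPositiveEigenvectors σ u v) (ht : TilingCondition σ u v)
    {n : ℤ} {e : Edges σ n} {x : Fin d → ℝ} (hx : x ∈ interior (fineBox σ u v n e))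
    (G : (Fin d → ℝ) → Set (UnitAddTorus (Fin d))) :
    ⋃ y ∈ {y | y ∈ interior (fineBox σ u v n e) ∧ torusMk y = torusMk x}, G y = G x := by
  have h : {y | y ∈ interior (fineBox σ u v n e) ∧ torusMk y = torusMk x} = {x} := by
    ext y
    constructor
    · rintro ⟨hy, hyx⟩
      obtain ⟨k, hk⟩ := torusMk_eq_iff.mp hyx
      exact (H.eq_of_mem_interior_fineBox ht hy hx hk).2
    · rintro rfl
      exact ⟨hx, rfl⟩
  rw [h, Set.biUnion_singleton]

theorem fineHorizontal_torusMk (H : HasPositiveEigenvectors σ u v) (ht : TilingCondition σ u v)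
    {n : ℤ} {e : Edges σ n} {x : Fin d → ℝ} (hx : x ∈ interior (fineBox σ u v n e)) :
    fineHorizontal σ u v n e (torusMk x) = torusMk '' {y ∈ interior (fineBox σ u v n e) |
      y ⬝ᵥ vVec (incSeq σ) v n = x ⬝ᵥ vVec (incSeq σ) v n} := by
  rw [fineHorizontal, H.biUnion_lifts ht hx, H.singleton_sub_relInterior hx]

theorem fineVertical_torusMk (H : HasPositiveEigenvectors σ u v) (ht : TilingCondition σ u v)
    {n : ℤ} {e : Edges σ n} {x : Fin d → ℝ} (hx : x ∈ interior (fineBox σ u v n e)) :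
    fineVertical σ u v n e (torusMk x) = torusMk '' {y ∈ interior (fineBox σ u v n e) |
      piN σ u v n y = piN σ u v n x} := by
  rw [fineVertical, H.biUnion_lifts ht hx, H.singleton_add_relInterior hx]

theorem image_fiber_eq_or_disjoint (H : HasPositiveEigenvectors σ u v)
    (ht : TilingCondition σ u v) {n : ℤ} (e : Edges σ n) {Z : Type*} (φ : (Fin d → ℝ) → Z)
    (x y : Fin d → ℝ) :
    torusMk '' {z ∈ interior (fineBox σ u v n e) | φ z = φ x} =
        torusMk '' {z ∈ interior (fineBox σ u v n e) | φ z = φ y} ∨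
      Disjoint (torusMk '' {z ∈ interior (fineBox σ u v n e) | φ z = φ x})
        (torusMk '' {z ∈ interior (fineBox σ u v n e) | φ z = φ y}) := by
  by_cases hxy : φ x = φ y
  · left
    rw [hxy]
  · right
    rw [Set.disjoint_left]
    rintro _ ⟨z, ⟨hz, hzx⟩, rfl⟩ ⟨w, ⟨hw, hwy⟩, hwz⟩
    obtain ⟨k, hk⟩ := torusMk_eq_iff.mp hwz
    rw [(H.eq_of_mem_interior_fineBox ht hw hz hk).2] at hwy
    exact hxy (hzx.symm.trans hwy)

theorem isTransverse (H : HasPositiveEigenvectors σ u v) (ht : TilingCondition σ u v) (n : ℤ)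
    (e : Edges σ n) : IsTransverse (finePartition σ u v n e) (fineHorizontal σ u v n e)
      (fineVertical σ u v n e) where
  h_subset := by
    rintro _ ⟨x, hx, rfl⟩
    rw [H.fineHorizontal_torusMk ht hx]
    exact Set.image_mono fun y hy => hy.1
  v_subset := by
    rintro _ ⟨x, hx, rfl⟩
    rw [H.fineVertical_torusMk ht hx]
    exact Set.image_mono fun y hy => hy.1
  mem_h := by
    rintro _ ⟨x, hx, rfl⟩
    rw [H.fineHorizontal_torusMk ht hx]
    exact ⟨x, ⟨hx, rfl⟩, rfl⟩
  mem_v := by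
    rintro _ ⟨x, hx, rfl⟩
    rw [H.fineVertical_torusMk ht hx]
    exact ⟨x, ⟨hx, rfl⟩, rfl⟩
  h_partition := by
    rintro _ ⟨x, hx, rfl⟩ _ ⟨y, hy, rfl⟩
    rw [H.fineHorizontal_torusMk ht hx, H.fineHorizontal_torusMk ht hy]
    exact H.image_fiber_eq_or_disjoint ht e (fun z => z ⬝ᵥ vVec (incSeq σ) v n) x y
  v_partition := by
    rintro _ ⟨x, hx, rfl⟩ _ ⟨y, hy, rfl⟩
    rw [H.fineVertical_torusMk ht hx, H.fineVertical_torusMk ht hy]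
    exact H.image_fiber_eq_or_disjoint ht e (piN σ u v n) x y
  transverse := by
    rintro _ ⟨x, hx, rfl⟩ _ ⟨y, hy, rfl⟩
    have hu := H.uVec_dotProduct_ne_zero n
    rw [H.fineHorizontal_torusMk ht hx, H.fineVertical_torusMk ht hy]
    -- The point with the height of `x` and the base coordinate of `y`; it stays in the box because
    -- the box is a product.
    have h1 : (piTildeN σ u v n x + piN σ u v n y) ⬝ᵥ vVec (incSeq σ) v n =
        x ⬝ᵥ vVec (incSeq σ) v n := by
      rw [add_dotProduct, piN, projHyp_dotProduct hu, add_zero]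
      exact projLine_dotProduct hu x
    have h2 : piN σ u v n (piTildeN σ u v n x + piN σ u v n y) = piN σ u v n y := by
      rw [piN_add]
      conv_rhs => rw [← zero_add (piN σ u v n y)]
      congr 1
      · exact projHyp_smul_self hu _
      · exact projHyp_of_dotProduct_eq_zero (projHyp_dotProduct hu _)
    have h3 : piTildeN σ u v n x + piN σ u v n y ∈ interior (fineBox σ u v n e) := by
      rw [H.mem_interior_fineBox_iff, h1]
      exact ⟨(H.mem_interior_fineBox_iff.mp hx).1,
        mem_interior_of_piN_eq h2.symm (H.mem_interior_fineBox_iff.mp hy).2⟩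
    exact ⟨_, ⟨_, ⟨h3, h1⟩, rfl⟩, ⟨_, ⟨h3, h2⟩, rfl⟩⟩

/-- Lifts of a point and of its image under the mapping family. -/
theorem mulVec_eq_of_mappingFamily (H : HasPositiveEigenvectors σ u v)
    (ht : TilingCondition σ u v) {n : ℤ} {e : Edges σ n} {e' : Edges σ (n + 1)}
    {x y : Fin d → ℝ} (hx : x ∈ interior (fineBox σ u v n e))
    (hy : y ∈ interior (fineBox σ u v (n + 1) e'))
    (hxy : mappingFamily σ H.unimodular n (torusMk x) = torusMk y) :
    e'.1.1 = e.1.2.2 ∧ incSeq σ n *ᵥ y = x + abel e.1.2.1 := by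
  have h1 : torusMk (incSeq σ n *ᵥ y) = torusMk x := by
    rw [incSeq, ← torusEnd_torusMk, ← hxy]
    exact (mappingFamily σ H.unimodular n).symm_apply_apply _
  obtain ⟨k, hk⟩ := torusMk_eq_iff.mp h1
  exact H.eq_of_mem_interior_fineBox_of_mem_interior_rauzyBox ht hx
    (interior_mono (H.fineBox_subset_rauzyBox _ e') hy) hk

theorem mappingFamily_torusMk_eq (H : HasPositiveEigenvectors σ u v) {n : ℤ} {x y : Fin d → ℝ}
    {p : FreeMonoid (Fin d)} (h : incSeq σ n *ᵥ y = x + abel p) :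
    mappingFamily σ H.unimodular n (torusMk x) = torusMk y := by
  have h1 : torusMk x = (mappingFamily σ H.unimodular n).symm (torusMk y) := by
    change torusMk x = torusEnd _ (torusMk y)
    rw [torusEnd_torusMk]
    change _ = torusMk (incSeq σ n *ᵥ y)
    rw [h, eq_comm, torusMk_eq_iff]
    exact ⟨_, by rw [intVec_occ]⟩
  rw [h1]
  exact (mappingFamily σ H.unimodular n).apply_symm_apply _

/-- The base of `e'` is contained in `R_{n+1}(b)`, which is the whole base of `e` seen from level `n
+ 1`. -/
theorem mem_interior_of_horizontal (H : HasPositiveEigenvectors σ u v) {n : ℤ} {e : Edges σ n}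
    {e' : Edges σ (n + 1)} (hee' : e'.1.1 = e.1.2.2) {x y : Fin d → ℝ}
    (h : incSeq σ n *ᵥ y = x + abel e.1.2.1) (hy : y ∈ interior (fineBox σ u v (n + 1) e')) :
    x ∈ interior {x | -piN σ u v n x ∈ fineFractal σ u v n e} := by
  have hcont : Continuous fun z : Fin d → ℝ => (incSeq σ n)⁻¹ *ᵥ (z + abel e.1.2.1) := by fun_prop
  have hyx : (incSeq σ n)⁻¹ *ᵥ (x + abel e.1.2.1) = y :=
    H.incSeq_mulVec_injective n (by rw [H.incSeq_mulVec_inv, h])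
  have hy' := (H.mem_interior_fineBox_iff.mp hy).2
  rw [← hyx] at hy'
  refine interior_mono ?_ (preimage_interior_subset_interior_preimage hcont hy')
  intro z hz
  refine (H.neg_piN_mem_fineFractal_iff (H.incSeq_mulVec_inv n _)).mpr ?_
  rw [← hee']
  exact H.fineFractal_subset _ _ hz

theorem propertyM (H : HasPositiveEigenvectors σ u v) (ht : TilingCondition σ u v)
    (hc : ∀ n, IsCompact (rauzyFractal σ u v n)) :
    PropertyM (mappingFamily σ H.unimodular) (finePartition σ u v) (fineHorizontal σ u v)
      (fineVertical σ u v) where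
  partition := H.isTopologicalPartition_finePartition ht hc
  transverse := H.isTransverse ht
  horizontal := by
    rintro n e e' _ ⟨⟨_, ⟨x, hx, rfl⟩, hxy⟩, y, hy, rfl⟩
    obtain ⟨hee', h⟩ := H.mulVec_eq_of_mappingFamily ht hx hy hxy
    rw [← hxy, Homeomorph.symm_apply_apply, H.fineHorizontal_torusMk ht hx, hxy,
      H.fineHorizontal_torusMk ht hy]
    rintro _ ⟨y', ⟨hy', hyy'⟩, rfl⟩
    have h' : incSeq σ n *ᵥ y' = (incSeq σ n *ᵥ y' - abel e.1.2.1) + abel e.1.2.1 := by simp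
    have hdot : (incSeq σ n *ᵥ y' - abel e.1.2.1) ⬝ᵥ vVec (incSeq σ) v n =
        x ⬝ᵥ vVec (incSeq σ) v n := by
      have h1 := H.incSeq_mulVec_dotProduct_of_eq h
      have h2 := H.incSeq_mulVec_dotProduct_of_eq h'
      linarith
    refine ⟨_, ⟨incSeq σ n *ᵥ y' - abel e.1.2.1, ⟨?_, hdot⟩, rfl⟩,
      H.mappingFamily_torusMk_eq h'⟩
    -- The height of this preimage is that of `x`; only its base coordinate has to be controlled.
    rw [H.mem_interior_fineBox_iff, hdot]
    exact ⟨(H.mem_interior_fineBox_iff.mp hx).1, H.mem_interior_of_horizontal hee' h' hy'⟩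
  vertical := by
    rintro n e e' _ ⟨⟨_, ⟨x, hx, rfl⟩, hxy⟩, y, hy, rfl⟩
    obtain ⟨hee', h⟩ := H.mulVec_eq_of_mappingFamily ht hx hy hxy
    rw [← hxy, Homeomorph.symm_apply_apply, H.fineVertical_torusMk ht hx, hxy,
      H.fineVertical_torusMk ht hy]
    rintro _ ⟨_, ⟨x', ⟨hx', hxx'⟩, rfl⟩, rfl⟩
    have h' := H.incSeq_mulVec_inv n (x' + abel e.1.2.1)
    rw [H.mappingFamily_torusMk_eq h']
    set y' := (incSeq σ n)⁻¹ *ᵥ (x' + abel e.1.2.1)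
    have hpi : piN σ u v (n + 1) y' = piN σ u v (n + 1) y := by
      apply H.incSeq_mulVec_injective n
      simp only [← piN_incSeq_mulVec H.unimodular, h, h', piN_add, hxx']
    refine ⟨y', ⟨?_, hpi⟩, rfl⟩
    rw [H.mem_interior_fineBox_iff]
    refine ⟨?_, mem_interior_of_piN_eq hpi.symm (H.mem_interior_fineBox_iff.mp hy).2⟩
    -- The box of `e'` has the full height `v_{n+1}(b)`, and the slab coming from `e` fits between
    -- `0` and that height.
    rw [H.incSeq_mulVec_dotProduct_of_eq h', hee']
    have h1 := H.abel_add_vVec_le n e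
    have h2 := H.abel_dotProduct_nonneg n e.1.2.1
    have h3 := (H.mem_interior_fineBox_iff.mp hx').1
    exact ⟨by linarith [h3.1], by linarith [h3.2]⟩

end HasPositiveEigenvectors

end RauzyPropertyM

/-! ### Kronecker's theorem for linear flows on the torus. -/

section Kronecker

open Filter Topology UnitAddTorus

variable {d : ℕ}

theorem torusMk_add (x y : Fin d → ℝ) : torusMk (x + y) = torusMk x + torusMk y := rfl

/-- The one-parameter subgroup of the torus with a given direction. -/
def torusFlow (u : Fin d → ℝ) : ℝ →+ UnitAddTorus (Fin d) where
  toFun t := torusMk (t • u)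
  map_zero' := by rw [zero_smul]; rfl
  map_add' s t := by rw [add_smul, torusMk_add]

theorem continuous_torusFlow (u : Fin d → ℝ) : Continuous (torusFlow u) :=
  continuous_torusMk.comp (by fun_prop)

theorem mFourier_add_apply (k : Fin d → ℤ) (x y : UnitAddTorus (Fin d)) :
    mFourier k (x + y) = mFourier k x * mFourier k y := by
  simp only [mFourier, ContinuousMap.coe_mk, ← Finset.prod_mul_distrib]
  refine Finset.prod_congr rfl fun i _ => ?_
  rw [Pi.add_apply, fourier_apply, fourier_apply, fourier_apply, smul_add, AddCircle.toCircle_add,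
    Circle.coe_mul]

theorem mFourier_torusFlow (k : Fin d → ℤ) (u : Fin d → ℝ) (t : ℝ) :
    mFourier k (torusFlow u t) =
      Complex.exp (2 * Real.pi * Complex.I * (intVec k ⬝ᵥ u : ℝ) * t) := by
  have h : ∀ i, fourier (k i) (torusFlow u t i) =
      Complex.exp (2 * Real.pi * Complex.I * (k i * u i : ℝ) * t) := by
    intro i
    change fourier (k i) (((t • u) i : ℝ) : UnitAddCircle) = _
    rw [fourier_coe_apply]
    congr 1
    simp
    ring
  simp only [mFourier, ContinuousMap.coe_mk, h]
  rw [← Complex.exp_sum, ← Finset.sum_mul, ← Finset.mul_sum, ← Complex.ofReal_sum]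
  rfl

/-- The primitive of a nontrivial character along the flow is bounded, so dividing by `T` kills it.
-/
theorem tendsto_average_mFourier {u : Fin d → ℝ} {k : Fin d → ℤ} (hk : intVec k ⬝ᵥ u ≠ 0) :
    Tendsto (fun T : ℝ => (T : ℂ)⁻¹ * ∫ t in (0 : ℝ)..T, mFourier k (torusFlow u t)) atTop
      (𝓝 0) := by
  set c : ℂ := 2 * Real.pi * Complex.I * (intVec k ⬝ᵥ u : ℝ) with hc
  have hc0 : c ≠ 0 := by
    simp [hc, Real.pi_ne_zero, Complex.I_ne_zero, hk]
  have hint : ∀ T : ℝ, ∫ t in (0 : ℝ)..T, mFourier k (torusFlow u t) =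
      (mFourier k (torusFlow u T) - 1) / c := by
    intro T
    simp only [mFourier_torusFlow, ← hc]
    rw [integral_exp_mul_complex hc0]
    simp
  have hb : ∀ T : ℝ, ‖∫ t in (0 : ℝ)..T, mFourier k (torusFlow u t)‖ ≤ 2 / ‖c‖ := by
    intro T
    rw [hint, norm_div]
    gcongr
    refine (norm_sub_le _ _).trans ?_
    have := ((mFourier k).norm_coe_le_norm (torusFlow u T)).trans_eq mFourier_norm
    rw [norm_one]
    linarith
  have h0 : Tendsto (fun T : ℝ => T⁻¹ * (2 / ‖c‖)) atTop (𝓝 0) := by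
    simpa using tendsto_inv_atTop_zero.mul_const (2 / ‖c‖)
  refine squeeze_zero_norm' ?_ h0
  filter_upwards [eventually_gt_atTop 0] with T hT
  rw [norm_mul, norm_inv, Complex.norm_real, Real.norm_of_nonneg hT.le]
  gcongr
  exact hb T

/-- For trigonometric polynomials, the averages along two parallel orbits are asymptotically
equal. -/
theorem tendsto_average_sub {u : Fin d → ℝ} (hu : ∀ k : Fin d → ℤ, k ≠ 0 → intVec k ⬝ᵥ u ≠ 0)
    (x : UnitAddTorus (Fin d)) {P : C(UnitAddTorus (Fin d), ℂ)}
    (hP : P ∈ Submodule.span ℂ (Set.range (mFourier (d := Fin d)))) :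
    Tendsto (fun T : ℝ => (T : ℂ)⁻¹ * ∫ t in (0 : ℝ)..T,
      (P (torusFlow u t) - P (x + torusFlow u t))) atTop (𝓝 0) := by
  have hcont : ∀ Q : C(UnitAddTorus (Fin d), ℂ),
      Continuous fun t : ℝ => Q (torusFlow u t) - Q (x + torusFlow u t) := fun Q =>
    (Q.continuous.comp (continuous_torusFlow u)).sub
      (Q.continuous.comp (continuous_const.add (continuous_torusFlow u)))
  induction hP using Submodule.span_induction with
  | mem P hP =>
    obtain ⟨k, rfl⟩ := hP
    rcases eq_or_ne k 0 with rfl | hk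
    · simp [mFourier_zero]
    · have := (tendsto_average_mFourier (hu k hk)).const_mul (1 - mFourier k x)
      rw [mul_zero] at this
      refine this.congr fun T => ?_
      rw [mul_left_comm, ← intervalIntegral.integral_const_mul]
      congr 1
      refine intervalIntegral.integral_congr fun t _ => ?_
      simp only [mFourier_add_apply]
      ring
  | zero => simp
  | add P Q _ _ hP hQ =>
    have := hP.add hQ
    rw [add_zero] at this
    refine this.congr fun T => ?_
    rw [← mul_add, ← intervalIntegral.integral_add ((hcont P).intervalIntegrable _ _)
      ((hcont Q).intervalIntegrable _ _)]
    congr 1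
    refine intervalIntegral.integral_congr fun t _ => ?_
    simp only [ContinuousMap.add_apply]
    ring
  | smul c P _ hP =>
    have := hP.const_mul c
    rw [mul_zero] at this
    refine this.congr fun T => ?_
    rw [mul_left_comm, ← intervalIntegral.integral_const_mul]
    congr 1
    refine intervalIntegral.integral_congr fun t _ => ?_
    simp only [ContinuousMap.smul_apply, smul_eq_mul]
    ring

/-- Kronecker's theorem for one-parameter subgroups of the torus. -/
theorem denseRange_torusFlow {u : Fin d → ℝ}
    (hu : ∀ k : Fin d → ℤ, k ≠ 0 → intVec k ⬝ᵥ u ≠ 0) : DenseRange (torusFlow u) := by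
  set K := (torusFlow u).range.topologicalClosure with hK
  have hKc : IsClosed (K : Set (UnitAddTorus (Fin d))) :=
    AddSubgroup.isClosed_topologicalClosure _
  have hKm : ∀ t, torusFlow u t ∈ K := fun t =>
    AddSubgroup.le_topologicalClosure _ ⟨t, rfl⟩
  intro x
  change x ∈ K
  by_contra hx
  -- The closed subgroup `K` and its coset `x + K` are disjoint, so a continuous function separates
  -- them. Along the orbit of `0` it is `0` and along the orbit of `x` it is `1`, whereas a
  -- trigonometric polynomial has asymptotically equal averages on both.
  have hdisj : Disjoint (K : Set (UnitAddTorus (Fin d))) ((fun y => y - x) ⁻¹' K) := by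
    rw [Set.disjoint_left]
    intro y hy hyx
    have := K.sub_mem hy hyx
    rw [sub_sub_cancel] at this
    exact hx this
  obtain ⟨g, hg0, hg1, -⟩ := exists_continuous_zero_one_of_isClosed hKc
    (hKc.preimage (continuous_id.sub continuous_const)) hdisj
  let G : C(UnitAddTorus (Fin d), ℂ) := ⟨fun y => (g y : ℂ), by fun_prop⟩
  have hG : G ∈ closure
      (Submodule.span ℂ (Set.range (mFourier (d := Fin d))) : Set C(UnitAddTorus (Fin d), ℂ)) := by
    rw [← Submodule.topologicalClosure_coe, span_mFourier_closure_eq_top]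
    trivial
  -- Two errors of `1/4` leave a discrepancy of at least `1/2` between the averages.
  obtain ⟨P, hP, hGP⟩ := Metric.mem_closure_iff.mp hG (1 / 4) (by norm_num)
  have hGP' : ∀ y, ‖G y - P y‖ ≤ 1 / 4 := fun y =>
    (dist_eq_norm (G y) (P y)).symm.trans_le ((ContinuousMap.dist_apply_le_dist y).trans hGP.le)
  have hlim := ((tendsto_average_sub hu x hP).add_const 1).norm
  rw [zero_add, norm_one] at hlim
  have hle : (1 : ℝ) ≤ 1 / 2 := by
    refine le_of_tendsto hlim ?_
    filter_upwards [eventually_gt_atTop 0] with T hT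
    have hTc : (T : ℂ) ≠ 0 := by exact_mod_cast hT.ne'
    have h1 : (T : ℂ)⁻¹ * (∫ t in (0 : ℝ)..T, (P (torusFlow u t) - P (x + torusFlow u t))) + 1 =
        (T : ℂ)⁻¹ * ∫ t in (0 : ℝ)..T, (P (torusFlow u t) - P (x + torusFlow u t) + 1) := by
      rw [intervalIntegral.integral_add, mul_add]
      · simp [hTc]
      · refine Continuous.intervalIntegrable ?_ _ _
        exact (P.continuous.comp (continuous_torusFlow u)).sub
          (P.continuous.comp (continuous_const.add (continuous_torusFlow u)))
      · exact intervalIntegrable_const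
    have h2 : ‖∫ t in (0 : ℝ)..T, (P (torusFlow u t) - P (x + torusFlow u t) + 1)‖ ≤
        1 / 2 * |T - 0| := by
      refine intervalIntegral.norm_integral_le_of_norm_le_const fun t _ => ?_
      have e0 : G (torusFlow u t) = 0 := by
        change ((g (torusFlow u t) : ℝ) : ℂ) = 0
        rw [hg0 (hKm t)]
        simp
      have e1 : G (x + torusFlow u t) = 1 := by
        change ((g (x + torusFlow u t) : ℝ) : ℂ) = 1
        rw [hg1 (show x + torusFlow u t - x ∈ K by rw [add_sub_cancel_left]; exact hKm t)]
        simp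
      have e : P (torusFlow u t) - P (x + torusFlow u t) + 1 =
          (G (x + torusFlow u t) - P (x + torusFlow u t)) -
            (G (torusFlow u t) - P (torusFlow u t)) := by
        rw [e0, e1]
        ring
      rw [e]
      refine (norm_sub_le _ _).trans ?_
      linarith [hGP' (x + torusFlow u t), hGP' (torusFlow u t)]
    rw [h1, norm_mul, norm_inv, Complex.norm_real, Real.norm_of_nonneg hT.le]
    rw [sub_zero, abs_of_pos hT] at h2
    rw [inv_mul_le_iff₀ hT]
    linarith
  norm_num at hle

end Kronecker

/-! ### Growth of the heights, rational independence, and pairs of points in a common tile. -/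

section Generating

open Filter Topology

variable {d : ℕ} {σ : ℤ → Substitution d} {u v : Fin d → ℝ}

theorem intVec_dotProduct_abel (k : Fin d → ℤ) (p : FreeMonoid (Fin d)) :
    ∃ m : ℤ, (m : ℝ) = intVec k ⬝ᵥ abel p :=
  ⟨∑ i, k i * (occ p i : ℤ), by simp [intVec, abel, dotProduct]⟩

theorem isClosed_range_intVec : IsClosed (Set.range (intVec (d := d))) := by
  have h : Set.range (intVec (d := d)) = Set.univ.pi fun _ => Set.range (Int.cast : ℤ → ℝ) := by
    ext x
    simp only [Set.mem_range, Set.mem_univ_pi]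
    refine ⟨?_, fun h => ?_⟩
    · rintro ⟨k, rfl⟩ i
      exact ⟨k i, rfl⟩
    · choose k hk using h
      exact ⟨k, funext hk⟩
  rw [h]
  exact isClosed_set_pi fun _ _ => Int.isClosedEmbedding_coe_real.isClosed_range

namespace HasPositiveEigenvectors

/-- The tiling condition forces the coordinates of `u` to be rationally independent. -/
theorem intVec_dotProduct_ne_zero (ht : TilingCondition σ u v) {k : Fin d → ℤ} (hk : k ≠ 0) :
    intVec k ⬝ᵥ u ≠ 0 := by
  intro h0
  -- If `k · u = 0`, neither `π_0` nor a displacement along `u` changes `k · x`. All tiles then lie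
  -- in the closed set where `k · x` is an integer, which is not all of `ℝ^d`.
  set S : Set (Fin d → ℝ) := {x | ∃ m : ℤ, (m : ℝ) = intVec k ⬝ᵥ x} with hS
  have hSc : IsClosed S := by
    have : Continuous fun x : Fin d → ℝ => intVec k ⬝ᵥ x := by
      unfold dotProduct
      fun_prop
    exact Int.isClosedEmbedding_coe_real.isClosed_range.preimage this
  have hsub : ∀ a, rauzySubtile σ u v 0 (FreeMonoid.of a) ⊆ S := by
    refine fun a => closure_minimal ?_ hSc
    rintro _ ⟨p, -, rfl⟩
    obtain ⟨m, hm⟩ := intVec_dotProduct_abel k p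
    refine ⟨m, ?_⟩
    rw [piN, projHyp, uVec_zero, dotProduct_sub, dotProduct_smul, h0, smul_zero, sub_zero, hm]
  have huniv : ∀ x, x ∈ S := by
    intro x
    have hx := Set.mem_univ x
    rw [← (ht.tiling 0).cover] at hx
    obtain ⟨⟨l, a⟩, _, rfl, _, ⟨_, ⟨y, -, rfl⟩, r, hr, rfl⟩, rfl⟩ := Set.mem_iUnion.mp hx
    obtain ⟨m, hm⟩ := hsub a hr
    refine ⟨∑ i, k i * l i - m, ?_⟩
    change _ = intVec k ⬝ᵥ (intVec l + (piTildeN σ u v 0 y - r))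
    rw [dotProduct_add, dotProduct_sub, ← hm, piTildeN, projLine, uVec_zero, dotProduct_smul, h0]
    simp [intVec, dotProduct]
    ring
  obtain ⟨i, hi⟩ := Function.ne_iff.mp hk
  have hi' : (k i : ℝ) ≠ 0 := by exact_mod_cast hi
  obtain ⟨m, hm⟩ := huniv (Pi.single i (2 * (k i : ℝ))⁻¹)
  rw [dotProduct_single, intVec] at hm
  have h2 : (2 * m : ℝ) = 1 := by
    rw [hm]
    field_simp
  have h3 : 2 * m = 1 := by exact_mod_cast h2
  omega

theorem matProd_incSeq_apply (σ : ℤ → Substitution d) (n : ℤ) (k : ℕ) (a b : Fin d) :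
    matProd (incSeq σ) n k a b = (occ (substComp σ n k (FreeMonoid.of b)) a : ℝ) := by
  have := congrFun (matProd_mulVec_abel σ n k (FreeMonoid.of b)) a
  rw [abel_of, Matrix.mulVec_single_one] at this
  exact this

/-- Positive entries of an integer matrix are at least `1`. -/
theorem sum_vVec_le (H : HasPositiveEigenvectors σ u v) {n : ℤ} {k : ℕ}
    (hk : ∀ a b, 0 < matProd (incSeq σ) n k a b) (b : Fin d) :
    ∑ a, vVec (incSeq σ) v n a ≤ vVec (incSeq σ) v (n + k) b := by
  rw [H.matProd_vVec_apply]
  refine Finset.sum_le_sum fun a _ => le_mul_of_one_le_left (H.vVec_nonneg n a) ?_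
  have := hk a b
  rw [matProd_incSeq_apply] at this
  rw [abel]
  exact_mod_cast this

/-- Summing over the `d ≥ 2` letters doubles the total height across each positive block. Iterated
forwards this gives unbounded heights, iterated backwards heights tending to `0`. -/
theorem two_mul_sum_vVec_le (hd : 2 ≤ d) (H : HasPositiveEigenvectors σ u v) {n : ℤ} {k : ℕ}
    (hk : ∀ a b, 0 < matProd (incSeq σ) n k a b) :
    2 * ∑ a, vVec (incSeq σ) v n a ≤ ∑ a, vVec (incSeq σ) v (n + k) a := by
  have h1 : 0 ≤ ∑ a, vVec (incSeq σ) v n a := Finset.sum_nonneg fun a _ => H.vVec_nonneg n a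
  have h2 : ∑ _b : Fin d, ∑ a, vVec (incSeq σ) v n a ≤ ∑ b, vVec (incSeq σ) v (n + k) b :=
    Finset.sum_le_sum fun b _ => H.sum_vVec_le hk b
  rw [Finset.sum_const, Finset.card_univ, Fintype.card_fin, nsmul_eq_mul] at h2
  have h3 : (2 : ℝ) ≤ d := by exact_mod_cast hd
  nlinarith

theorem sum_vVec_zero_pos (H : HasPositiveEigenvectors σ u v) :
    0 < ∑ a, vVec (incSeq σ) v 0 a := by
  have hv := H.vVec_nonneg 0
  rw [vVec_zero] at hv ⊢
  refine lt_of_le_of_ne (Finset.sum_nonneg fun a _ => hv a) fun h => ?_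
  have h1 := (Finset.sum_eq_zero_iff_of_nonneg fun a _ => hv a).mp h.symm
  have h2 : v = 0 := funext fun a => h1 a (Finset.mem_univ a)
  have := H.dotProduct_pos
  rw [h2, dotProduct_zero] at this
  exact lt_irrefl _ this

theorem exists_le_vVec (hd : 2 ≤ d) (H : HasPositiveEigenvectors σ u v)
    (hp : IsPrimitive (incSeq σ)) (C : ℝ) : ∃ n : ℕ, ∀ a, C ≤ vVec (incSeq σ) v n a := by
  have key : ∀ j : ℕ, ∃ n : ℕ,
      2 ^ j * ∑ a, vVec (incSeq σ) v 0 a ≤ ∑ a, vVec (incSeq σ) v n a := by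
    intro j
    induction j with
    | zero => exact ⟨0, by simp⟩
    | succ j ih =>
      obtain ⟨n, hn⟩ := ih
      obtain ⟨k, -, hk⟩ := hp n
      refine ⟨n + k, ?_⟩
      have := H.two_mul_sum_vVec_le hd hk
      push_cast
      rw [pow_succ']
      linarith
  have hpos := H.sum_vVec_zero_pos
  obtain ⟨j, hj⟩ := pow_unbounded_of_one_lt (C / ∑ a, vVec (incSeq σ) v 0 a) one_lt_two
  rw [div_lt_iff₀ hpos] at hj
  obtain ⟨n, hn⟩ := key j
  -- One more positive block passes from a large sum to large individual coordinates.
  obtain ⟨k, -, hk⟩ := hp n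
  refine ⟨n + k, fun a => ?_⟩
  have := H.sum_vVec_le hk a
  push_cast
  linarith

theorem exists_vVec_neg_lt (hd : 2 ≤ d) (H : HasPositiveEigenvectors σ u v)
    (hp : IsPrimitivePast (incSeq σ)) {ε : ℝ} (hε : 0 < ε) :
    ∃ n : ℕ, ∀ a, vVec (incSeq σ) v (-n) a < ε := by
  have key : ∀ j : ℕ, ∃ n : ℕ,
      2 ^ j * ∑ a, vVec (incSeq σ) v (-n) a ≤ ∑ a, vVec (incSeq σ) v 0 a := by
    intro j
    induction j with
    | zero => exact ⟨0, by simp⟩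
    | succ j ih =>
      obtain ⟨n, hn⟩ := ih
      obtain ⟨k, -, hk⟩ := hp (-n)
      refine ⟨n + k, ?_⟩
      have := H.two_mul_sum_vVec_le hd hk
      rw [sub_add_cancel] at this
      have h1 : -((n + k : ℕ) : ℤ) = -(n : ℤ) - k := by push_cast; ring
      rw [h1, pow_succ, mul_assoc]
      exact (mul_le_mul_of_nonneg_left this (by positivity)).trans hn
  obtain ⟨j, hj⟩ := pow_unbounded_of_one_lt ((∑ a, vVec (incSeq σ) v 0 a) / ε) one_lt_two
  rw [div_lt_iff₀ hε] at hj
  obtain ⟨n, hn⟩ := key j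
  refine ⟨n, fun a => ?_⟩
  have h1 : vVec (incSeq σ) v (-n) a ≤ ∑ a, vVec (incSeq σ) v (-n) a :=
    Finset.single_le_sum (fun b _ => H.vVec_nonneg (-n) b) (Finset.mem_univ a)
  have h2 : (0 : ℝ) < 2 ^ j := by positivity
  exact lt_of_mul_lt_mul_left
    (((mul_le_mul_of_nonneg_left h1 h2.le).trans hn).trans_lt hj) h2.le

end HasPositiveEigenvectors

/-- Pairs `(x, z)` such that `x` and `x - z` lie in a common tile of the level `0`. -/
def commonTile (σ : ℤ → Substitution d) (u v : Fin d → ℝ) : Set ((Fin d → ℝ) × (Fin d → ℝ)) :=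
  {xz | ∃ (m : Fin d → ℤ) (c : Fin d), xz.1 - intVec m ∈ rauzyBox σ u v 0 c ∧
    xz.1 - xz.2 - intVec m ∈ rauzyBox σ u v 0 c}

namespace HasPositiveEigenvectors

/-- The set is the sum of a closed lattice, acting on the first component, and a compact set. -/
theorem isClosed_commonTile (hc : ∀ n, IsCompact (rauzyFractal σ u v n)) :
    IsClosed (commonTile σ u v) := by
  have h : commonTile σ u v = (Set.range (intVec (d := d)) ×ˢ {0}) +
      (fun xy : (Fin d → ℝ) × (Fin d → ℝ) => (xy.1, xy.1 - xy.2)) ''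
        ⋃ c, rauzyBox σ u v 0 c ×ˢ rauzyBox σ u v 0 c := by
    ext ⟨x, z⟩
    constructor
    · rintro ⟨m, c, h1, h2⟩
      refine ⟨(intVec m, 0), ⟨⟨m, rfl⟩, rfl⟩, _,
        ⟨(x - intVec m, x - z - intVec m), Set.mem_iUnion.mpr ⟨c, h1, h2⟩, rfl⟩, ?_⟩
      simp
    · rintro ⟨⟨_, _⟩, ⟨⟨m, rfl⟩, rfl⟩, _, ⟨⟨y, w⟩, hyw, rfl⟩, hxz⟩
      obtain ⟨c, h1, h2⟩ := Set.mem_iUnion.mp hyw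
      simp only [Prod.mk_add_mk, zero_add, Prod.mk.injEq] at hxz
      obtain ⟨rfl, rfl⟩ := hxz
      refine ⟨m, c, ?_, ?_⟩
      · simpa using h1
      · have : intVec m + y - (y - w) - intVec m = w := by abel
        simpa only [this] using h2
  rw [h]
  refine (isClosed_range_intVec.prod isClosed_singleton).add_right_of_isCompact
    (IsCompact.image ?_ (by fun_prop))
  exact isCompact_iUnion fun c => (isCompact_rauzyBox hc 0 c).prod (isCompact_rauzyBox hc 0 c)

theorem commonTile_add_intVec {x z : Fin d → ℝ} (h : (x, z) ∈ commonTile σ u v)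
    (k : Fin d → ℤ) : (x + intVec k, z) ∈ commonTile σ u v := by
  obtain ⟨m, c, h1, h2⟩ := h
  refine ⟨m + k, c, ?_, ?_⟩
  · simpa only [intVec_add, add_sub_add_right_eq_sub] using h1
  · have : x + intVec k - z - (intVec m + intVec k) = x - z - intVec m := by abel
    simpa only [intVec_add, this] using h2

/-- No nonzero translation moves every point inside its tile. -/
theorem eq_zero_of_forall_mem_commonTile (ht : TilingCondition σ u v)
    (hc : ∀ n, IsCompact (rauzyFractal σ u v n)) {z : Fin d → ℝ}
    (hz : ∀ x, (x, z) ∈ commonTile σ u v) : z = 0 := by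
  let T : (Fin d → ℤ) × Fin d → Set (Fin d → ℝ) := fun i => {fun j => (i.1 j : ℝ)} +
    rauzyBox σ u v 0 i.2
  have hT : ∀ i x, x ∈ T i ↔ x - intVec i.1 ∈ rauzyBox σ u v 0 i.2 := by
    intro i x
    constructor
    · rintro ⟨_, rfl, y, hy, rfl⟩
      change intVec i.1 + y - intVec i.1 ∈ _
      rwa [add_sub_cancel_left]
    · exact fun h => ⟨_, rfl, _, h, add_sub_cancel _ _⟩
  -- The null set of points lying in two tiles. A generic `x` has none of the points `x - k z` in
  -- it, so each of them determines its tile.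
  let N : Set (Fin d → ℝ) := ⋃ ij : {ij : ((Fin d → ℤ) × Fin d) × ((Fin d → ℤ) × Fin d) //
    ij.1 ≠ ij.2}, T ij.1.1 ∩ T ij.1.2
  have hN : MeasureTheory.volume N = 0 :=
    MeasureTheory.measure_iUnion_null fun ij => (ht.tiling 0).disjoint _ _ ij.2
  have hN' : MeasureTheory.volume (⋃ k : ℕ, (fun x => x + -((k : ℝ) • z)) ⁻¹' N) = 0 :=
    MeasureTheory.measure_iUnion_null fun k => by
      rw [MeasureTheory.measure_preimage_add_right, hN]
  obtain ⟨x, hx⟩ : ∃ x, x ∉ ⋃ k : ℕ, (fun x => x + -((k : ℝ) • z)) ⁻¹' N := by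
    by_contra! hall
    rw [Set.eq_univ_of_forall hall] at hN'
    exact (isOpen_univ.measure_pos MeasureTheory.volume Set.univ_nonempty).ne' hN'
  have hx' : ∀ k : ℕ, x - (k : ℝ) • z ∉ N := by
    intro k hk
    exact hx (Set.mem_iUnion.mpr ⟨k, by simpa [sub_eq_add_neg] using hk⟩)
  obtain ⟨m, c, h0, -⟩ := hz x
  have hstep : ∀ k : ℕ, x - (k : ℝ) • z ∈ T (m, c) := by
    intro k
    induction k with
    | zero => simpa [hT] using h0
    | succ k ih =>
      obtain ⟨m', c', h1, h2⟩ := hz (x - (k : ℝ) • z)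
      have hi : (m, c) = (m', c') := by
        by_contra hne
        exact hx' k (Set.mem_iUnion.mpr ⟨⟨(_, _), hne⟩, ih, (hT (m', c') _).mpr h1⟩)
      rw [hi, hT]
      have : x - ((k + 1 : ℕ) : ℝ) • z = x - (k : ℝ) • z - z := by
        push_cast
        rw [add_smul, one_smul, sub_add_eq_sub_sub]
      rw [this]
      exact h2
  obtain ⟨C, hC⟩ := (isCompact_rauzyBox hc 0 c).isBounded.exists_norm_le
  by_contra hz0
  obtain ⟨k, hk⟩ := exists_nat_gt ((C + ‖x - intVec m‖) / ‖z‖)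
  rw [div_lt_iff₀ (norm_pos_iff.mpr hz0)] at hk
  have h1 := hC _ ((hT _ _).mp (hstep k))
  have h2 : (k : ℝ) • z = (x - intVec m) - (x - (k : ℝ) • z - intVec m) := by abel
  have h3 : ‖(k : ℝ) • z‖ = k * ‖z‖ := by rw [norm_smul, Real.norm_natCast]
  have h4 := norm_sub_le (x - intVec m) (x - (k : ℝ) • z - intVec m)
  rw [← h2, h3] at h4
  simp only at h1
  linarith

end HasPositiveEigenvectors

end Generating

/-! ### Contraction of the renormalized subtiles. -/

section Contraction

open Filter Topology

variable {d : ℕ} {σ : ℤ → Substitution d} {u v : Fin d → ℝ}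

namespace HasPositiveEigenvectors

/-- Points of the vertical segment through `-M_{[0,n)} r`, `r ∈ R_n(a)`, lie in a tile of the
level `0` that depends on the height only. -/
theorem mem_commonTile_of_mem_rauzySubtile (H : HasPositiveEigenvectors σ u v) {n : ℕ} {a : Fin d}
    {r r' : Fin d → ℝ} (hr : r ∈ rauzySubtile σ u v n (FreeMonoid.of a))
    (hr' : r' ∈ rauzySubtile σ u v n (FreeMonoid.of a)) {t : ℝ} (h0 : 0 ≤ t)
    (h1 : t ≤ vVec (incSeq σ) v n a) :
    ((t / (u ⬝ᵥ v)) • u - matProd (incSeq σ) 0 n *ᵥ r, matProd (incSeq σ) 0 n *ᵥ (r' - r)) ∈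
      commonTile σ u v := by
  have huv := H.dotProduct_pos.ne'
  have hv := H.matProd_vVec_apply 0 n a
  rw [zero_add] at hv
  rw [hv] at h1
  -- The letter `c` after `p` in `σ_{[0,n)}(a)` is selected by the height `t` alone, so `r` and `r'`
  -- lead to the same tile.
  obtain ⟨p, c, hp, h2, h3⟩ := exists_prefixOf_dotProduct_le _ (substComp_of_ne_one σ 0 n a) h0 h1
  have key : ∀ s ∈ rauzySubtile σ u v n (FreeMonoid.of a),
      (t / (u ⬝ᵥ v)) • u - matProd (incSeq σ) 0 n *ᵥ s - abel p ∈ rauzyBox σ u v 0 c := by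
    intro s hs
    have hmem := piN_add_matProd_mulVec_mem_rauzySubtile H.unimodular u v hp (x := s)
      (by rwa [zero_add])
    have hs0 : (matProd (incSeq σ) 0 n *ᵥ s) ⬝ᵥ vVec (incSeq σ) v 0 = 0 := by
      rw [matProd_mulVec_dotProduct_vVec H.isUnit_det, zero_add]
      exact H.rauzySubtile_dotProduct n _ s hs
    have hu0 : (t / (u ⬝ᵥ v)) • u ⬝ᵥ vVec (incSeq σ) v 0 = t := by
      rw [vVec_zero, smul_dotProduct, smul_eq_mul, div_mul_cancel₀ _ huv]
    rw [H.mem_rauzyBox_iff, sub_dotProduct, sub_dotProduct, hs0, hu0, piN_sub, piN_sub]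
    refine ⟨⟨by linarith, by linarith⟩, ?_⟩
    have e1 : piN σ u v 0 ((t / (u ⬝ᵥ v)) • u) = 0 := by
      rw [piN, uVec_zero, vVec_zero, projHyp_smul_self huv]
    have e2 : piN σ u v 0 (matProd (incSeq σ) 0 n *ᵥ s) = matProd (incSeq σ) 0 n *ᵥ s :=
      projHyp_of_dotProduct_eq_zero hs0
    have e3 : -(piN σ u v 0 ((t / (u ⬝ᵥ v)) • u) - piN σ u v 0 (matProd (incSeq σ) 0 n *ᵥ s) -
        piN σ u v 0 (abel p)) = piN σ u v 0 (abel p) + matProd (incSeq σ) 0 n *ᵥ s := by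
      rw [e1, e2]
      abel
    rwa [e3]
  refine ⟨fun b => (occ p b : ℤ), c, ?_, ?_⟩
  · rw [intVec_occ]
    exact key r hr
  · have e : (t / (u ⬝ᵥ v)) • u - matProd (incSeq σ) 0 n *ᵥ r -
        matProd (incSeq σ) 0 n *ᵥ (r' - r) = (t / (u ⬝ᵥ v)) • u - matProd (incSeq σ) 0 n *ᵥ r' := by
      rw [Matrix.mulVec_sub]
      abel
    rw [intVec_occ, e]
    exact key r' hr'

/-- The renormalized subtiles `M_{[0,n)} R_n(a)` have arbitrarily small diameter. -/
theorem exists_norm_matProd_mulVec_sub_lt (hd : 2 ≤ d) (H : HasPositiveEigenvectors σ u v)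
    (ht : TilingCondition σ u v) (hc : ∀ n, IsCompact (rauzyFractal σ u v n)) {ε : ℝ}
    (hε : 0 < ε) : ∃ n : ℕ, ∀ a, ∀ r ∈ rauzySubtile σ u v n (FreeMonoid.of a),
      ∀ r' ∈ rauzySubtile σ u v n (FreeMonoid.of a),
        ‖matProd (incSeq σ) 0 n *ᵥ (r' - r)‖ < ε := by
  by_contra! hcon
  -- Normalized to height `1`, so that moving by `t • w` changes the height by `t`.
  set w : Fin d → ℝ := (u ⬝ᵥ v)⁻¹ • u with hw
  choose n hn using fun j : ℕ => H.exists_le_vVec hd ht.primitive j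
  choose a r hr r' hr' hrr using fun j => hcon (n j)
  set z : ℕ → Fin d → ℝ := fun j => matProd (incSeq σ) 0 (n j) *ᵥ (r' j - r j) with hz
  -- Midpoint of a segment of length `j` in height, available since all heights at level `n j` are
  -- at least `j`.
  set s : ℕ → Fin d → ℝ := fun j =>
    ((j : ℝ) / 2) • w - matProd (incSeq σ) 0 (n j) *ᵥ r j with hs
  have hline : ∀ (j : ℕ) (t : ℝ), |t| ≤ (j : ℝ) / 2 → (s j + t • w, z j) ∈ commonTile σ u v := by
    intro j t htj
    obtain ⟨h1, h2⟩ := abs_le.mp htj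
    have := H.mem_commonTile_of_mem_rauzySubtile (hr j) (hr' j) (t := (j : ℝ) / 2 + t)
      (by linarith) (by linarith [hn j (a j)])
    have e : s j + t • w = (((j : ℝ) / 2 + t) / (u ⬝ᵥ v)) • u -
        matProd (incSeq σ) 0 (n j) *ᵥ r j := by
      rw [hs, hw, div_eq_mul_inv, ← smul_smul, add_smul]
      beta_reduce
      abel
    rw [e]
    exact this
  -- The midpoints are reduced modulo the lattice into the unit cube, and the `z j` are differences
  -- of points of one tile. A subsequence of both therefore converges.
  set y : ℕ → Fin d → ℝ := fun j i => Int.fract (s j i) with hy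
  have hys : ∀ j, y j = s j + intVec fun i => -⌊s j i⌋ := by
    intro j
    funext i
    simp [hy, intVec, Int.fract, sub_eq_add_neg]
  have hline' : ∀ (j : ℕ) (t : ℝ), |t| ≤ (j : ℝ) / 2 →
      (y j + t • w, z j) ∈ commonTile σ u v := by
    intro j t htj
    have := commonTile_add_intVec (hline j t htj) fun i => -⌊s j i⌋
    rwa [add_right_comm, ← hys] at this
  have hyK : ∀ j, y j ∈ Set.Icc (0 : Fin d → ℝ) 1 := fun j =>
    ⟨fun i => Int.fract_nonneg _, fun i => (Int.fract_lt_one _).le⟩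
  have hzK : ∀ j, z j ∈ ⋃ c, (rauzyBox σ u v 0 c + -rauzyBox σ u v 0 c) := by
    intro j
    obtain ⟨m, c, h1, h2⟩ := hline' j 0 (by rw [abs_zero]; positivity)
    refine Set.mem_iUnion.mpr ⟨c, _, h1, -_, Set.neg_mem_neg.mpr h2, ?_⟩
    simp
  have hcomp : IsCompact (Set.Icc (0 : Fin d → ℝ) 1 ×ˢ
      ⋃ c, (rauzyBox σ u v 0 c + -rauzyBox σ u v 0 c)) :=
    isCompact_Icc.prod (isCompact_iUnion fun c =>
      (isCompact_rauzyBox hc 0 c).add (isCompact_rauzyBox hc 0 c).neg)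
  obtain ⟨⟨y', z'⟩, -, φ, hφ, hlim⟩ := hcomp.tendsto_subseq (x := fun j => (y j, z j))
    fun j => ⟨hyK j, hzK j⟩
  have hlimy : Tendsto (fun j => y (φ j)) atTop (𝓝 y') :=
    (continuous_fst.tendsto _).comp hlim
  have hlimz : Tendsto (fun j => z (φ j)) atTop (𝓝 z') :=
    (continuous_snd.tendsto _).comp hlim
  have hcl := isClosed_commonTile hc
  have hline'' : ∀ t : ℝ, (y' + t • w, z') ∈ commonTile σ u v := by
    intro t
    refine hcl.mem_of_tendsto ((hlimy.add_const (t • w)).prodMk_nhds hlimz) ?_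
    obtain ⟨N, hN⟩ := exists_nat_ge (2 * |t|)
    filter_upwards [eventually_ge_atTop N] with j hj
    refine hline' _ _ ?_
    have : (N : ℝ) ≤ φ j := by exact_mod_cast hj.trans (hφ.id_le j)
    linarith
  have hdense : DenseRange (torusFlow w) := denseRange_torusFlow fun k hk => by
    rw [hw, dotProduct_smul, smul_eq_mul]
    exact mul_ne_zero (inv_ne_zero H.dotProduct_pos.ne') (intVec_dotProduct_ne_zero ht hk)
  -- The translates of the limit line by the lattice are dense, and `commonTile` is closed and
  -- invariant under the lattice in its first component.
  have hall : ∀ x, (x, z') ∈ commonTile σ u v := by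
    intro x
    have hx : x - y' ∈ closure (torusMk ⁻¹' Set.range (torusFlow w)) :=
      hdense.preimage isOpenMap_torusMk _
    have := map_mem_closure (f := fun x => (y' + x, z')) (by fun_prop) hx
      (t := commonTile σ u v) ?_
    · rw [hcl.closure_eq] at this
      simpa using this
    · rintro x' ⟨t, hxt⟩
      obtain ⟨k, rfl⟩ := torusMk_eq_iff.mp hxt.symm
      change (y' + (t • w + intVec k), z') ∈ commonTile σ u v
      rw [← add_assoc]
      exact commonTile_add_intVec (hline'' t) k
  have h0 := eq_zero_of_forall_mem_commonTile ht hc hall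
  have hge : ε ≤ ‖z'‖ := ge_of_tendsto hlimz.norm (Eventually.of_forall fun j => hrr (φ j))
  rw [h0, norm_zero] at hge
  linarith

end HasPositiveEigenvectors

end Contraction

/-! ### The generating property. -/

section Generating

open Filter Topology

variable {d : ℕ} {σ : ℤ → Substitution d} {u v : Fin d → ℝ}

theorem dist_torusMk_le (x y : Fin d → ℝ) : dist (torusMk x) (torusMk y) ≤ ‖x - y‖ := by
  refine (dist_pi_le_iff (norm_nonneg _)).mpr fun i => ?_
  rw [dist_eq_norm]
  change ‖((x i : ℝ) : UnitAddCircle) - ((y i : ℝ) : UnitAddCircle)‖ ≤ _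
  rw [← AddCircle.coe_sub]
  exact QuotientAddGroup.norm_mk_le_norm.trans (norm_le_pi_norm (x - y) i)

/-- The points of the disjoint union of the tori whose orbit follows the itinerary `i` at the times
`|k| < N`. -/
def cylinder (f : ∀ n : ℤ, (fun _ : ℤ => UnitAddTorus (Fin d)) n ≃ₜ
      (fun _ : ℤ => UnitAddTorus (Fin d)) (n + 1)) {ι : ℤ → Type*}
    (R : ∀ n, ι n → Set (UnitAddTorus (Fin d))) (i : ∀ n, ι n) (N : ℕ) :
    Set (Σ n : ℤ, (fun _ : ℤ => UnitAddTorus (Fin d)) n) :=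
  ⋂ k ∈ {k : ℤ | |k| < N}, ⇑(totalMap f ^ k) ⁻¹' atom R k (i k)

namespace HasPositiveEigenvectors

/-- The lifts are chosen in the prescribed boxes; the translation between consecutive ones is then
`ℓ(p)`, a function of the itinerary only. The condition `0 < N` is there because an empty range of
times does not force `s` to lie at level `0`. -/
theorem exists_lift (H : HasPositiveEigenvectors σ u v) (ht : TilingCondition σ u v)
    {i : ∀ n, Edges σ n} {N : ℕ} {s : Σ n : ℤ, (fun _ : ℤ => UnitAddTorus (Fin d)) n}
    (hs : s ∈ cylinder (mappingFamily σ H.unimodular) (finePartition σ u v) i N) :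
    ∃ x : ℤ → Fin d → ℝ, (0 < N → s = ⟨0, torusMk (x 0)⟩) ∧
      (∀ k : ℤ, |k| < N → x k ∈ interior (fineBox σ u v k (i k))) ∧
      ∀ k : ℤ, |k| < N → |k + 1| < N →
        incSeq σ k *ᵥ x (k + 1) = x k + abel (i k).1.2.1 := by
  have h1 : ∀ k : ℤ, ∃ x : Fin d → ℝ, |k| < N → x ∈ interior (fineBox σ u v k (i k)) ∧
      (totalMap (mappingFamily σ H.unimodular) ^ k) s = ⟨k, torusMk x⟩ := by
    intro k
    by_cases hk : |k| < N
    · obtain ⟨_, ⟨x, hx, rfl⟩, hxs⟩ := Set.mem_iInter₂.mp hs k hk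
      exact ⟨x, fun _ => ⟨hx, hxs.symm⟩⟩
    · exact ⟨0, fun h => absurd h hk⟩
  choose x hx using h1
  refine ⟨x, fun hN => ?_, fun k hk => (hx k hk).1, fun k hk hk' => ?_⟩
  · have := (hx 0 (by simpa using hN)).2
    rwa [zpow_zero, Equiv.Perm.one_apply] at this
  · have h2 := (hx (k + 1) hk').2
    rw [add_comm, zpow_add, zpow_one, Equiv.Perm.mul_apply, (hx k hk).2, add_comm] at h2
    have h3 : mappingFamily σ H.unimodular k (torusMk (x k)) = torusMk (x (k + 1)) :=
      eq_of_heq (Sigma.mk.inj h2).2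
    exact (H.mulVec_eq_of_mappingFamily ht (hx k hk).1 (hx (k + 1) hk').1 h3).2

theorem matProd_mulVec_eq_of_forall {w : ℤ → Fin d → ℝ} {n : ℤ} {m : ℕ}
    (h : ∀ k : ℤ, n ≤ k → k < n + m → incSeq σ k *ᵥ w (k + 1) = w k) :
    matProd (incSeq σ) n m *ᵥ w (n + m) = w n := by
  induction m with
  | zero => simp [matProd]
  | succ m ih =>
    have h1 := h (n + m) (by omega) (by push_cast; omega)
    rw [matProd, ← Matrix.mulVec_mulVec]
    push_cast
    rw [← add_assoc, h1]
    exact ih fun k hk hk' => h k hk (by push_cast; omega)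

/-- The lifts of two points of a long cylinder are close to each other. -/
theorem exists_norm_sub_le (hd : 2 ≤ d) (H : HasPositiveEigenvectors σ u v)
    (ht : TilingCondition σ u v) (hc : ∀ n, IsCompact (rauzyFractal σ u v n))
    (hp : IsPrimitivePast (incSeq σ)) (i : ∀ n, Edges σ n) {ε : ℝ} (hε : 0 < ε) :
    ∃ N : ℕ, 0 < N ∧ ∀ s ∈ cylinder (mappingFamily σ H.unimodular) (finePartition σ u v) i N,
      ∀ t ∈ cylinder (mappingFamily σ H.unimodular) (finePartition σ u v) i N,
        ∃ x y : UnitAddTorus (Fin d), s = ⟨0, x⟩ ∧ t = ⟨0, y⟩ ∧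
          dist x y ≤ ε + ε / (u ⬝ᵥ v) * ‖u‖ := by
  obtain ⟨n, hn⟩ := H.exists_norm_matProd_mulVec_sub_lt hd ht hc hε
  obtain ⟨m, hm⟩ := H.exists_vVec_neg_lt hd hp hε
  -- Large enough for the times `n` and `-m` to satisfy `|k| < N`.
  refine ⟨n + m + 1, by omega, fun s hs t ht' => ?_⟩
  obtain ⟨x, hx0, hx, hxx⟩ := H.exists_lift ht hs
  obtain ⟨y, hy0, hy, hyy⟩ := H.exists_lift ht ht'
  refine ⟨_, _, hx0 (by omega), hy0 (by omega), (dist_torusMk_le _ _).trans ?_⟩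
  -- The translations `ℓ(p)` are the same for both orbits and cancel in the difference.
  set w : ℤ → Fin d → ℝ := fun k => x k - y k with hw
  have hww : ∀ k : ℤ, -(m : ℤ) ≤ k → k < n → incSeq σ k *ᵥ w (k + 1) = w k := by
    intro k h1 h2
    have ha : |k| < ((n + m + 1 : ℕ) : ℤ) := by rw [abs_lt]; push_cast; omega
    have hb : |k + 1| < ((n + m + 1 : ℕ) : ℤ) := by rw [abs_lt]; push_cast; omega
    rw [hw, Matrix.mulVec_sub, hxx k ha hb, hyy k ha hb]
    exact add_sub_add_right_eq_sub _ _ _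
  have hfut : matProd (incSeq σ) 0 n *ᵥ w n = w 0 := by
    have := matProd_mulVec_eq_of_forall (σ := σ) (w := w) (n := 0) (m := n)
      fun k h1 h2 => hww k (by omega) (by omega)
    rwa [zero_add] at this
  have hpast : matProd (incSeq σ) (-m) m *ᵥ w 0 = w (-m) := by
    have := matProd_mulVec_eq_of_forall (σ := σ) (w := w) (n := -m) (m := m)
      fun k h1 h2 => hww k (by omega) (by omega)
    rwa [neg_add_cancel] at this
  have hmem : ∀ {x : ℤ → Fin d → ℝ}, (∀ k : ℤ, |k| < ((n + m + 1 : ℕ) : ℤ) →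
      x k ∈ interior (fineBox σ u v k (i k))) →
      -piN σ u v n (x n) ∈ rauzySubtile σ u v n (FreeMonoid.of (i n).1.1) ∧
      0 ≤ x (-m) ⬝ᵥ vVec (incSeq σ) v (-m) ∧ x (-m) ⬝ᵥ vVec (incSeq σ) v (-m) < ε := by
    intro x hx
    have h1 := interior_subset (hx n (by rw [abs_lt]; push_cast; omega))
    have h2 := interior_subset (hx (-m) (by rw [abs_lt]; push_cast; omega))
    rw [H.mem_fineBox_iff] at h1 h2
    exact ⟨H.fineFractal_subset _ _ h1.2, h2.1.1, h2.1.2.trans_lt (hm _)⟩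
  have hhyp : ‖piN σ u v 0 (w 0)‖ ≤ ε := by
    have h1 := hn _ _ (hmem hy).1 _ (hmem hx).1
    have h2 : matProd (incSeq σ) 0 n *ᵥ (-piN σ u v n (x n) - -piN σ u v n (y n)) =
        -piN σ u v 0 (w 0) := by
      have h3 := piN_matProd_mulVec H.unimodular u v 0 n (w n)
      rw [zero_add, hfut, hw] at h3
      beta_reduce at h3
      rw [h3, ← Matrix.mulVec_neg, piN_sub]
      congr 1
      abel
    rw [h2, norm_neg] at h1
    exact h1.le
  have hlin : |w 0 ⬝ᵥ v| ≤ ε := by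
    have h1 := matProd_mulVec_dotProduct_vVec H.isUnit_det v (-m) m (w 0)
    rw [neg_add_cancel, vVec_zero, hpast] at h1
    rw [← h1, hw, sub_dotProduct, abs_le]
    have h2 := (hmem hx).2
    have h3 := (hmem hy).2
    exact ⟨by linarith [h2.1, h3.2], by linarith [h2.2, h3.1]⟩
  have hsplit : x 0 - y 0 = piN σ u v 0 (w 0) + piTildeN σ u v 0 (w 0) :=
    (projHyp_add_projLine _ _ _).symm
  rw [hsplit]
  refine (norm_add_le _ _).trans (add_le_add hhyp ?_)
  rw [piTildeN, projLine, uVec_zero, vVec_zero, norm_smul, norm_div, Real.norm_eq_abs,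
    Real.norm_of_nonneg H.dotProduct_pos.le]
  have := H.dotProduct_pos
  gcongr

theorem isGenerating (hd : 2 ≤ d) (H : HasPositiveEigenvectors σ u v)
    (ht : TilingCondition σ u v) (hc : ∀ n, IsCompact (rauzyFractal σ u v n))
    (hp : IsPrimitivePast (incSeq σ)) :
    IsGenerating (mappingFamily σ H.unimodular) (finePartition σ u v) := by
  intro i s hs t ht'
  have hs' : ∀ N, s ∈ closure
      (cylinder (mappingFamily σ H.unimodular) (finePartition σ u v) i N) := Set.mem_iInter.mp hs
  have ht'' : ∀ N, t ∈ closure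
      (cylinder (mappingFamily σ H.unimodular) (finePartition σ u v) i N) := Set.mem_iInter.mp ht'
  have key : ∀ ε : ℝ, 0 < ε → ∃ x y : UnitAddTorus (Fin d), s = ⟨0, x⟩ ∧ t = ⟨0, y⟩ ∧
      dist x y ≤ ε + ε / (u ⬝ᵥ v) * ‖u‖ := by
    intro ε hε
    obtain ⟨N, hN, h⟩ := H.exists_norm_sub_le hd ht hc hp i hε
    have hmem : (s, t) ∈ closure
        (cylinder (mappingFamily σ H.unimodular) (finePartition σ u v) i N ×ˢ
          cylinder (mappingFamily σ H.unimodular) (finePartition σ u v) i N) := by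
      rw [closure_prod_eq]
      exact ⟨hs' N, ht'' N⟩
    let g : UnitAddTorus (Fin d) → Σ n : ℤ, (fun _ : ℤ => UnitAddTorus (Fin d)) n :=
      fun x => ⟨0, x⟩
    have hg : IsClosedEmbedding g :=
      IsClosedEmbedding.sigmaMk (σ := fun _ : ℤ => UnitAddTorus (Fin d)) (i := 0)
    -- The estimate holds on cylinders, while the points lie only in their closures; level `0` is
    -- closed in the disjoint union, so the estimate is a closed condition on pairs.
    have hcl : IsClosed (Prod.map g g ''
        {xy | dist xy.1 xy.2 ≤ ε + ε / (u ⬝ᵥ v) * ‖u‖}) :=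
      (hg.prodMap hg).isClosedMap _ (isClosed_le continuous_dist continuous_const)
    obtain ⟨⟨x, y⟩, hxy, he⟩ := closure_minimal (fun st hst => by
      obtain ⟨x, y, hx, hy, hxy⟩ := h st.1 hst.1 st.2 hst.2
      exact ⟨(x, y), hxy, Prod.ext hx.symm hy.symm⟩) hcl hmem
    exact ⟨x, y, (congrArg Prod.fst he).symm, (congrArg Prod.snd he).symm, hxy⟩
  -- Used only to place both points at level `0`.
  obtain ⟨x, y, rfl, rfl, -⟩ := key 1 one_pos
  have huv := H.dotProduct_pos
  set C := 1 + ‖u‖ / (u ⬝ᵥ v) with hC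
  have hC0 : 0 < C := by positivity
  have hdist : ∀ δ : ℝ, 0 < δ → dist x y ≤ δ := by
    intro δ hδ
    obtain ⟨x', y', hx, hy, hxy⟩ := key (δ / C) (by positivity)
    obtain rfl : x = x' := eq_of_heq (Sigma.mk.inj hx).2
    obtain rfl : y = y' := eq_of_heq (Sigma.mk.inj hy).2
    refine hxy.trans_eq ?_
    have : δ / C + δ / C / (u ⬝ᵥ v) * ‖u‖ = δ / C * C := by
      rw [hC]
      ring
    rw [this, div_mul_cancel₀ _ hC0.ne']
  have : x = y := dist_le_zero.mp (le_of_forall_pos_le_add fun δ hδ => by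
    rw [zero_add]
    exact hdist δ hδ)
  rw [this]

end HasPositiveEigenvectors

end Generating

end SAdic

theorem mainTheorem4 (d : ℕ) (hd : 2 ≤ d) (σ : ℤ → SAdic.Substitution d)
    (hσ : ∀ n, (σ n).IsUnimodular) (u v : Fin d → ℝ)
    (htiling : SAdic.TilingCondition σ u v)
    (hcompact : ∀ n, IsCompact (SAdic.rauzyFractal σ u v n)) :
    SAdic.PropertyM (SAdic.mappingFamily σ hσ) (SAdic.finePartition σ u v)
        (SAdic.fineHorizontal σ u v) (SAdic.fineVertical σ u v) ∧
      SAdic.IsMarkovPartition (SAdic.mappingFamily σ hσ) (SAdic.finePartition σ u v) ∧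
      (SAdic.IsPrimitive (SAdic.incSeq σ) ∧ SAdic.IsPrimitivePast (SAdic.incSeq σ) →
        SAdic.IsGenerating (SAdic.mappingFamily σ hσ) (SAdic.finePartition σ u v)) := by
  have H := htiling.hasPositiveEigenvectors hσ
  have hM := H.propertyM htiling hcompact
  exact ⟨hM, hM.isMarkovPartition, fun hp => H.isGenerating hd htiling hcompact hp.2⟩
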